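/- Let $\mathcal A$ be a finite alphabet with the discrete topology, and let $\mathcal A^+$ be the set of non-empty finite words over $\mathcal A$. A random substitution $\vartheta$ assigns to each letter $a \in \mathcal A$ a non-empty finite set $\vartheta(a) \subset \mathcal A^+$. It extends to words by $\vartheta(v_1\cdots v_n)=\vartheta(v_1)\cdots\vartheta(v_n)$ (all concatenations) and to sets of words by taking unions; $\vartheta^m(a)$ denotes the $m$-fold iterate applied to $a$, with $\vartheta^0(a)=\{a\}$. A marginal of $\vartheta$ is a map $\theta\colon\mathcal A\to\mathcal A^+$ with $\theta(a)\in\vartheta(a)$ for all $a$; its substitution matrix is $M_{ab}=|\theta(b)|_a$, the number of occurrences of $a$ in $\theta(b)$. Assume that (i) $\vartheta$ is primitive: for some $n\ge 1$, $\vartheta^n$ has a marginal whose substitution matrix has a strictly positive power; (ii) $\vartheta$ is geometrically compatible: there are $\lambda>1$ and a vector $L=(L_a)_{a\in\mathcal A}$ with strictly positive entries such that $L$ is a left eigenvector with eigenvalue $\lambda$ of the substitution matrix of every marginal of $\vartheta$. Fix any such $\lambda$ and $L$, and put $L(w)=\sum_{a}L_a|w|_a$ for $w \in \mathcal A^+$.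 Let $X_\vartheta\subset\mathcal A^{\mathbb Z}$ be the set of bi-infinite sequences all of whose non-empty finite subwords occur as subwords of words in $\bigcup_{n\ge 0,\,a\in\mathcal A}\vartheta^n(a)$, with left shift $S$. Let $(Y_\vartheta,T)$ be the geometric hull, that is, the suspension flow of $(X_\vartheta,S)$ with roof function $\pi(x)=L_{x_0}$: the quotient of $X_\vartheta\times\mathbb R$ by the equivalence relation generated by $(x,s+\pi(x))\sim(Sx,s)$, with $T_t(x,s)=(x,s+t)$. Its topological entropy $h_{\mathrm{top}}(Y_\vartheta)$ is that of the time-one map $T_1$. Then for every $a\in\mathcal A$ and $m \geq 0$ all words in $\vartheta^m(a)$ have the same geometric length, denoted $L(\vartheta^m(a))$; the limit $$h_a^G=\lim_{m\to\infty}\frac{\log \#\vartheta^m(a)}{L(\vartheta^m(a))}$$ exists in $\mathbb R$; and $h_a^G=h_{\mathrm{top}}(Y_\vartheta)$. -/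

import Mathlib

open Set Filter Topology

/-! ### Random substitutions -/

/-- A random substitution on `A`: each letter is sent to a non-empty finite set of
non-empty words. -/
structure RandomSubstitution (A : Type*) where
  toFun : A → Finset (List A)
  nonempty' : ∀ a, (toFun a).Nonempty
  ne_nil' : ∀ a, ∀ w ∈ toFun a, w ≠ []

namespace RandomSubstitution

/-- The substitution matrix `M a b = |θ(b)|_a` of a map `θ` from letters to words. -/
noncomputable def substMatrix {A : Type*} [DecidableEq A] (θ : A → List A) : Matrix A A ℝ :=
  Matrix.of fun a b => ((θ b).count a : ℝ)

/-- The geometric length `L(w) = ∑ a, L_a |w|_a` of a word. -/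
noncomputable def geomLength {A : Type*} [Fintype A] [DecidableEq A] (L : A → ℝ)
    (w : List A) : ℝ :=
  ∑ a, L a * (w.count a : ℝ)

/-- Action on words: `ϑ(v₁ ⋯ vₙ) = ϑ(v₁) ⋯ ϑ(vₙ)`, the set of all concatenations. -/
def onWord {A : Type*} [DecidableEq A] (ϑ : RandomSubstitution A) : List A → Finset (List A)
  | [] => {[]}
  | a :: w => Finset.image₂ (fun u v => u ++ v) (ϑ.toFun a) (ϑ.onWord w)

/-- Action on finite sets of words: the union of the images of the words. -/
def onWords {A : Type*} [DecidableEq A] (ϑ : RandomSubstitution A) (W : Finset (List A)) :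
    Finset (List A) :=
  W.biUnion ϑ.onWord

theorem onWord_nonempty {A : Type*} [DecidableEq A] (ϑ : RandomSubstitution A) (w : List A) :
    (ϑ.onWord w).Nonempty := by
  induction w with
  | nil => exact Finset.singleton_nonempty _
  | cons a w ih => exact Finset.Nonempty.image₂ (ϑ.nonempty' a) ih

theorem ne_nil_of_mem_onWord {A : Type*} [DecidableEq A] (ϑ : RandomSubstitution A)
    {w v : List A} (hw : w ≠ []) (hv : v ∈ ϑ.onWord w) : v ≠ [] := by
  cases w with
  | nil => exact absurd rfl hw
  | cons a w =>
    obtain ⟨u, hu, u', -, rfl⟩ := Finset.mem_image₂.1 hv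
    exact List.append_ne_nil_of_left_ne_nil (ϑ.ne_nil' a u hu) u'

/-- The powers of a random substitution: `ϑ⁰(a) = {a}` and `ϑⁿ⁺¹(a) = ϑ(ϑⁿ(a))`. -/
def pow {A : Type*} [DecidableEq A] (ϑ : RandomSubstitution A) : ℕ → RandomSubstitution A
  | 0 =>
    { toFun := fun a => {[a]}
      nonempty' := fun _ => Finset.singleton_nonempty _
      ne_nil' := fun a w hw => by
        rw [Finset.mem_singleton.1 hw]; exact List.cons_ne_nil a [] }
  | n + 1 =>
    { toFun := fun a => ϑ.onWords ((ϑ.pow n).toFun a)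
      nonempty' := fun a =>
        ((ϑ.pow n).nonempty' a).biUnion fun w _ => ϑ.onWord_nonempty w
      ne_nil' := fun a w hw => by
        obtain ⟨u, hu, huw⟩ := Finset.mem_biUnion.1 hw
        exact ϑ.ne_nil_of_mem_onWord ((ϑ.pow n).ne_nil' a u hu) huw }

/-- A marginal of `ϑ`: a choice of one realisation `θ(a) ∈ ϑ(a)` for every letter. -/
def IsMarginal {A : Type*} (ϑ : RandomSubstitution A) (θ : A → List A) : Prop :=
  ∀ a, θ a ∈ ϑ.toFun a

/-- `ϑ` is primitive if some power `ϑⁿ`, `n ≥ 1`, has a marginal whose substitution matrix is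
primitive. -/
def IsPrimitive {A : Type*} [Fintype A] [DecidableEq A] (ϑ : RandomSubstitution A) : Prop :=
  ∃ n : ℕ, 0 < n ∧ ∃ θ : A → List A, (ϑ.pow n).IsMarginal θ ∧ (substMatrix θ).IsPrimitive

/-- `ϑ` is geometrically compatible, with inflation factor `lam` and length vector `L`. -/
structure IsGeomCompatible {A : Type*} [Fintype A] [DecidableEq A] (ϑ : RandomSubstitution A)
    (lam : ℝ) (L : A → ℝ) : Prop where
  one_lt : 1 < lam
  pos : ∀ a, 0 < L a
  left_eigenvector : ∀ θ : A → List A, ϑ.IsMarginal θ →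
    Matrix.vecMul L (substMatrix θ) = lam • L

/-- The language of `ϑ`: the non-empty subwords of inflation words. -/
def language {A : Type*} [DecidableEq A] (ϑ : RandomSubstitution A) : Set (List A) :=
  {v | v ≠ [] ∧ ∃ (n : ℕ) (a : A), ∃ w ∈ (ϑ.pow n).toFun a, v <:+: w}

/-- The word `x_i x_{i+1} ⋯ x_{i+n-1}` of a bi-infinite sequence. -/
def window {A : Type*} (x : ℤ → A) (i : ℤ) (n : ℕ) : List A :=
  List.ofFn fun k : Fin n => x (i + (k : ℕ))

/-- The subshift `X_ϑ`: the bi-infinite sequences all of whose non-empty finite subwords belong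
to the language of `ϑ`. -/
def subshift {A : Type*} [DecidableEq A] (ϑ : RandomSubstitution A) : Set (ℤ → A) :=
  {x | ∀ (i : ℤ) (n : ℕ), 0 < n → window x i n ∈ ϑ.language}

/-- The left shift `(S x)_k = x_{k+1}` on `X_ϑ`. -/
def shift {A : Type*} [DecidableEq A] (ϑ : RandomSubstitution A) (x : ϑ.subshift) :
    ϑ.subshift :=
  ⟨fun k => x.1 (k + 1), fun i n hn => by
    have h : window (fun k => x.1 (k + 1)) i n = window x.1 (i + 1) n := by
      unfold window
      congr 1
      funext k
      exact congrArg x.1 (by ring)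
    rw [h]
    exact x.2 (i + 1) n hn⟩

end RandomSubstitution

/-! ### Suspension flows -/

/-- The elementary identification `(x, s + π(x)) ∼ (S x, s)`. -/
def SuspensionRel {X : Type*} (S : X → X) (π : X → ℝ) (p q : X × ℝ) : Prop :=
  ∃ (x : X) (s : ℝ), p = (x, s + π x) ∧ q = (S x, s)

/-- The suspension of `(X, S)` with roof function `π`: the quotient of `X × ℝ` by the equivalence
relation generated by `(x, s + π(x)) ∼ (S x, s)`. -/
def Suspension {X : Type*} (S : X → X) (π : X → ℝ) : Type _ :=
  Quot (SuspensionRel S π)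

/-- The suspension carries the quotient topology. -/
instance {X : Type*} [TopologicalSpace X] (S : X → X) (π : X → ℝ) :
    TopologicalSpace (Suspension S π) :=
  inferInstanceAs (TopologicalSpace (Quot (SuspensionRel S π)))

/-- The suspension flow `T_t (x, s) = (x, s + t)`. -/
def suspensionFlow {X : Type*} [TopologicalSpace X] (S : X → X) (π : X → ℝ) :
    Flow ℝ (Suspension S π) where
  toFun t := Quot.map (fun p => (p.1, p.2 + t)) (by
    rintro _ _ ⟨x, s, rfl, rfl⟩
    exact ⟨x, s + t, by simp only [Prod.mk.injEq, true_and]; ring, rfl⟩)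
  cont' := by
    have hq : IsQuotientMap (Quot.mk (SuspensionRel S π)) := isQuotientMap_quot_mk
    refine hq.continuous_lift_prod_right ?_
    exact hq.continuous.comp (Continuous.prodMk (continuous_fst.comp continuous_snd)
      ((continuous_snd.comp continuous_snd).add continuous_fst))
  map_add' t₁ t₂ y := by
    induction y using Quot.ind with
    | mk p =>
      change Quot.mk _ (p.1, p.2 + (t₁ + t₂)) = Quot.mk _ (p.1, p.2 + t₂ + t₁)
      congr 2
      ring
  map_zero' y := by
    induction y using Quot.ind with
    | mk p =>
      change Quot.mk _ (p.1, p.2 + 0) = Quot.mk _ p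
      rw [add_zero]

/-! ### Topological entropy -/

/-- Topological entropy (Bowen–Dinaburg) of a self-map of a compact Hausdorff space: the supremum
over the neighbourhoods `U` of the diagonal of the exponential growth rate of the minimal number
of dynamical `(U, n)`-balls that cover the space. On a compact Hausdorff space the neighbourhoods
of the diagonal are exactly the entourages of the unique compatible uniformity. -/
noncomputable def topologicalEntropy {Y : Type*} [TopologicalSpace Y] (f : Y → Y) : EReal :=
  ⨆ U ∈ 𝓝ˢ (diagonal Y), Dynamics.coverEntropyEntourage f univ U

theorem topologicalEntropy_eq_coverEntropy {Y : Type*} [UniformSpace Y] [CompactSpace Y]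
    (f : Y → Y) : topologicalEntropy f = Dynamics.coverEntropy f univ := by
  unfold topologicalEntropy Dynamics.coverEntropy
  rw [nhdsSet_diagonal_eq_uniformity]

/-- The topological entropy of a flow is that of its time-one map. -/
noncomputable def Flow.topologicalEntropy {Y : Type*} [TopologicalSpace Y] (φ : Flow ℝ Y) :
    EReal :=
  _root_.topologicalEntropy (φ 1)

/-! ### The geometric hull and the geometric inflation word entropy -/

namespace RandomSubstitution

/-- The geometric hull `(Y_ϑ, T)`: the suspension flow of `(X_ϑ, S)` with roof function
`π(x) = L_{x₀}`. -/
def geometricHull {A : Type*} [TopologicalSpace A] [DecidableEq A]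
    (ϑ : RandomSubstitution A) (L : A → ℝ) :
    Flow ℝ (Suspension ϑ.shift (fun x : ϑ.subshift => L (x.1 0))) :=
  suspensionFlow ϑ.shift (fun x : ϑ.subshift => L (x.1 0))

/-- The geometric inflation word entropy of type `a` exists and equals `h`: for every `m`, all
words in `ϑᵐ(a)` have one and the same geometric length `ℓ m = L(ϑᵐ(a))`, and
`log #ϑᵐ(a) / L(ϑᵐ(a))` tends to `h`. -/
def HasGeomInflationWordEntropy {A : Type*} [Fintype A] [DecidableEq A]
    (ϑ : RandomSubstitution A) (L : A → ℝ) (a : A) (h : ℝ) : Prop :=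
  ∃ ℓ : ℕ → ℝ, (∀ m, ∀ w ∈ (ϑ.pow m).toFun a, geomLength L w = ℓ m) ∧
    Tendsto (fun m => Real.log (((ϑ.pow m).toFun a).card : ℝ) / ℓ m) atTop (𝓝 h)

end RandomSubstitution

/-! All words in `ϑᵐ(a)` have geometric length `λᵐ L_a`, so a word in `ϑᵐ(v)` splits uniquely into
images of the letters of `v`, and `log #ϑᵐ(v)` is additive over those letters
(`Inflates.log_card_onWord`). Write `r_m(a) = log #ϑᵐ(a) / (λᵐ L_a)`, and let `h` be the entropy of
the hull. Three inequalities are combined.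

Separation: every inflation word occurs in a point of the subshift (`exists_window_eq`). Two
distinct words of `ϑᵐ(a)` placed at the origin first differ in a tile ending by time `λᵐ L_a`, and
continuous tent functions on the hull detect this difference. Hence `#ϑᵐ(a)` is at most a covering
number at time about `λᵐ L_a` (`exists_card_le_coverMincard`), and `limsup r_m(a) ≤ h` for every
`a`.

Covering: up to a bounded factor, covering numbers at time `n` are bounded by the number of legal
words of geometric length at most `n + c` (`exists_coverMincard_le`). Each such word lies in some
word of `ϑᵐ(v)` with `λᵐ L(v) ≤ n + O(1)`. The choice of `v` contributes exponential rate `O(λ⁻ᵐ)`,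
and the choice inside `ϑᵐ(v)` contributes at most `max_b r_m(b)` by additivity (`card_language_le`).
Hence `h ≤ max_b r_m(b) + O(λ⁻ᵐ)` (`topologicalEntropy_le`).

Averaging: by primitivity some level-`N` image of each `a` contains every letter, so `r_{N+m}(a)`
dominates a weighted average of the `r_m(b)` with weights bounded below
(`exists_inflationRate_averaging`). No letter can then lag behind the maximum, and all rates
converge to `h` (`tendsto_of_averaging`). -/

namespace RandomSubstitution

theorem prefix_append_cases {A : Type*} {w u z : List A} (h : w <+: u ++ z) :
    w <+: u ∨ ∃ t, w = u ++ t ∧ t <+: z := by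
  obtain ⟨s, hs⟩ := h
  rcases List.append_eq_append_iff.1 hs with ⟨t, ht, -⟩ | ⟨t, ht, ht'⟩
  · exact Or.inl ⟨t, ht.symm⟩
  · exact Or.inr ⟨t, ht, s, ht'.symm⟩

/-! ### Action on words and the semigroup law for powers -/

section Words

variable {A : Type*} [DecidableEq A]

theorem mem_onWord_cons {σ : RandomSubstitution A} {a : A} {w z : List A} :
    z ∈ σ.onWord (a :: w) ↔ ∃ u ∈ σ.toFun a, ∃ v ∈ σ.onWord w, u ++ v = z :=
  Finset.mem_image₂

theorem mem_onWord_nil {σ : RandomSubstitution A} {z : List A} : z ∈ σ.onWord [] ↔ z = [] :=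
  Finset.mem_singleton

theorem mem_onWord_singleton {σ : RandomSubstitution A} {a : A} {z : List A} :
    z ∈ σ.onWord [a] ↔ z ∈ σ.toFun a := by
  simp [mem_onWord_cons, mem_onWord_nil]

theorem mem_onWord_append {σ : RandomSubstitution A} {u v z : List A} :
    z ∈ σ.onWord (u ++ v) ↔ ∃ x ∈ σ.onWord u, ∃ y ∈ σ.onWord v, x ++ y = z := by
  induction u generalizing z with
  | nil => simp [mem_onWord_nil]
  | cons a u ih =>
    simp only [List.cons_append, mem_onWord_cons, ih]
    constructor
    · rintro ⟨t, ht, _, ⟨x, hx, y, hy, rfl⟩, rfl⟩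
      exact ⟨t ++ x, ⟨t, ht, x, hx, rfl⟩, y, hy, List.append_assoc ..⟩
    · rintro ⟨_, ⟨t, ht, x, hx, rfl⟩, y, hy, rfl⟩
      exact ⟨t, ht, x ++ y, ⟨x, hx, y, hy, rfl⟩, (List.append_assoc ..).symm⟩

theorem flatMap_mem_onWord {σ : RandomSubstitution A} {θ : A → List A} (hθ : σ.IsMarginal θ)
    (w : List A) : w.flatMap θ ∈ σ.onWord w := by
  induction w with
  | nil => simp [mem_onWord_nil]
  | cons a w ih => exact mem_onWord_cons.2 ⟨θ a, hθ a, _, ih, rfl⟩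

theorem mem_pow_succ {ϑ : RandomSubstitution A} {n : ℕ} {a : A} {z : List A} :
    z ∈ (ϑ.pow (n + 1)).toFun a ↔ ∃ u ∈ (ϑ.pow n).toFun a, z ∈ ϑ.onWord u :=
  Finset.mem_biUnion

theorem mem_onWord_pow_zero {ϑ : RandomSubstitution A} {w z : List A} :
    z ∈ (ϑ.pow 0).onWord w ↔ z = w := by
  induction w generalizing z with
  | nil => exact mem_onWord_nil
  | cons a w ih =>
    have h0 : (ϑ.pow 0).toFun a = {[a]} := rfl
    simp [mem_onWord_cons, ih, h0, eq_comm]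

theorem mem_onWord_pow_succ {ϑ : RandomSubstitution A} {n : ℕ} {w z : List A} :
    z ∈ (ϑ.pow (n + 1)).onWord w ↔ ∃ u ∈ (ϑ.pow n).onWord w, z ∈ ϑ.onWord u := by
  induction w generalizing z with
  | nil => simp [mem_onWord_nil]
  | cons a w ih =>
    simp only [mem_onWord_cons, mem_pow_succ, ih]
    constructor
    · rintro ⟨x, ⟨u, hu, hx⟩, y, ⟨v, hv, hy⟩, rfl⟩
      exact ⟨u ++ v, ⟨u, hu, v, hv, rfl⟩, mem_onWord_append.2 ⟨x, hx, y, hy, rfl⟩⟩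
    · rintro ⟨_, ⟨u, hu, v, hv, rfl⟩, hz⟩
      obtain ⟨x, hx, y, hy, rfl⟩ := mem_onWord_append.1 hz
      exact ⟨x, ⟨u, hu, hx⟩, y, ⟨v, hv, hy⟩, rfl⟩

theorem mem_onWord_pow_add {ϑ : RandomSubstitution A} {m n : ℕ} {w z : List A} :
    z ∈ (ϑ.pow (m + n)).onWord w ↔ ∃ u ∈ (ϑ.pow m).onWord w, z ∈ (ϑ.pow n).onWord u := by
  induction n generalizing z with
  | zero => simp [mem_onWord_pow_zero]
  | succ n ih =>
    rw [← add_assoc]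
    simp only [mem_onWord_pow_succ, ih]
    grind

theorem mem_pow_add {ϑ : RandomSubstitution A} {m n : ℕ} {a : A} {z : List A} :
    z ∈ (ϑ.pow (m + n)).toFun a ↔ ∃ u ∈ (ϑ.pow m).toFun a, z ∈ (ϑ.pow n).onWord u := by
  simp only [← mem_onWord_singleton, mem_onWord_pow_add]

theorem exists_marginal_eq (ϑ : RandomSubstitution A) {a : A} {w : List A}
    (hw : w ∈ ϑ.toFun a) : ∃ θ, ϑ.IsMarginal θ ∧ θ a = w := by
  classical
  choose θ hθ using ϑ.nonempty'
  refine ⟨Function.update θ a w, fun b => ?_, Function.update_self ..⟩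
  by_cases h : b = a
  · subst h; simpa using hw
  · simpa [Function.update_of_ne h] using hθ b

end Words

/-! ### Geometric length, unique decomposition and desubstitution -/

section GeomLength

variable {A : Type*} [Fintype A] [DecidableEq A] {L : A → ℝ}

@[simp] theorem geomLength_nil : geomLength L [] = 0 := by simp [geomLength]

@[simp] theorem geomLength_append (u v : List A) :
    geomLength L (u ++ v) = geomLength L u + geomLength L v := by
  simp [geomLength, mul_add, Finset.sum_add_distrib]

@[simp] theorem geomLength_singleton (a : A) : geomLength L [a] = L a := by
  simp [geomLength, List.count_singleton]

theorem geomLength_cons (a : A) (w : List A) : geomLength L (a :: w) = L a + geomLength L w := by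
  rw [← List.singleton_append, geomLength_append, geomLength_singleton]

theorem geomLength_eq_sum_map (w : List A) : geomLength L w = (w.map L).sum := by
  induction w with
  | nil => simp
  | cons a w ih => simp [geomLength_cons, ih]

theorem mul_length_le_geomLength {c : ℝ} (hc : ∀ a, c ≤ L a) (w : List A) :
    c * w.length ≤ geomLength L w := by
  induction w with
  | nil => simp
  | cons a w ih => rw [geomLength_cons]; push_cast [List.length_cons]; linarith [hc a]

theorem geomLength_le_mul_length {c : ℝ} (hc : ∀ a, L a ≤ c) (w : List A) :
    geomLength L w ≤ c * w.length := by
  induction w with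
  | nil => simp
  | cons a w ih => rw [geomLength_cons]; push_cast [List.length_cons]; linarith [hc a]

theorem geomLength_nonneg (hL : ∀ a, 0 < L a) (w : List A) : 0 ≤ geomLength L w := by
  simpa using mul_length_le_geomLength (fun a => (hL a).le) w

theorem geomLength_pos (hL : ∀ a, 0 < L a) {w : List A} (hw : w ≠ []) : 0 < geomLength L w := by
  cases w with
  | nil => exact absurd rfl hw
  | cons a w => rw [geomLength_cons]; linarith [hL a, geomLength_nonneg hL w]

theorem eq_of_prefix_of_geomLength_eq (hL : ∀ a, 0 < L a) {u v : List A} (h : u <+: v)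
    (hl : geomLength L u = geomLength L v) : u = v := by
  obtain ⟨t, rfl⟩ := h
  by_contra hne
  have : t ≠ [] := by rintro rfl; simp at hne
  have := geomLength_pos hL this
  simp at hl
  linarith

/-- Every realisation of `σ` on a letter `a` has geometric length `μ L_a`. -/
def Inflates (σ : RandomSubstitution A) (L : A → ℝ) (μ : ℝ) : Prop :=
  ∀ a, ∀ w ∈ σ.toFun a, geomLength L w = μ * L a

theorem Inflates.onWord {σ : RandomSubstitution A} {μ : ℝ} (h : σ.Inflates L μ) {w z : List A}
    (hz : z ∈ σ.onWord w) : geomLength L z = μ * geomLength L w := by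
  induction w generalizing z with
  | nil => simp [mem_onWord_nil.1 hz]
  | cons a w ih =>
    obtain ⟨u, hu, v, hv, rfl⟩ := mem_onWord_cons.1 hz
    rw [geomLength_append, h a u hu, ih hv, geomLength_cons]; ring

/-- Each realisation on `a` is the value at `a` of some marginal, and its geometric length is the
`a`-th coordinate in the eigenvector equation. -/
theorem IsGeomCompatible.inflates {ϑ : RandomSubstitution A} {lam : ℝ}
    (h : ϑ.IsGeomCompatible lam L) : ϑ.Inflates L lam := by
  intro a w hw
  obtain ⟨θ, hθ, rfl⟩ := ϑ.exists_marginal_eq hw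
  have := congrFun (h.left_eigenvector θ hθ) a
  simpa [Matrix.vecMul, dotProduct, substMatrix, geomLength] using this

theorem Inflates.pow {ϑ : RandomSubstitution A} {lam : ℝ} (h : ϑ.Inflates L lam) (m : ℕ) :
    (ϑ.pow m).Inflates L (lam ^ m) := by
  induction m with
  | zero =>
    intro a w hw
    rw [Finset.mem_singleton.1 hw]; simp
  | succ m ih =>
    intro a w hw
    obtain ⟨u, hu, hw⟩ := mem_pow_succ.1 hw
    rw [h.onWord hw, ih a u hu]; ring

/-- Concatenation is injective here: if `u ++ v = u' ++ v'` with `u`, `u'` realisations of the same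
letter, one is a prefix of the other, and equal geometric lengths force `u = u'`. -/
theorem Inflates.card_onWord {σ : RandomSubstitution A} {μ : ℝ} (h : σ.Inflates L μ)
    (hL : ∀ a, 0 < L a) (w : List A) :
    (σ.onWord w).card = (w.map fun a => (σ.toFun a).card).prod := by
  induction w with
  | nil => rfl
  | cons a w ih =>
    rw [List.map_cons, List.prod_cons, ← ih]
    refine Finset.card_image₂_iff.2 ?_
    rintro ⟨u, v⟩ hu ⟨u', v'⟩ hu' heq
    simp only [Set.mem_prod, Finset.mem_coe] at hu hu'
    have hl : geomLength L u = geomLength L u' := by rw [h a u hu.1, h a u' hu'.1]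
    simp only at heq
    have : u = u' := by
      rcases List.append_eq_append_iff.1 heq with ⟨t, ht, -⟩ | ⟨t, ht, -⟩
      · exact eq_of_prefix_of_geomLength_eq hL ⟨t, ht.symm⟩ hl
      · exact (eq_of_prefix_of_geomLength_eq hL ⟨t, ht.symm⟩ hl.symm).symm
    subst this
    simpa using heq

theorem Inflates.log_card_onWord {σ : RandomSubstitution A} {μ : ℝ} (h : σ.Inflates L μ)
    (hL : ∀ a, 0 < L a) (w : List A) :
    Real.log (σ.onWord w).card = (w.map fun a => Real.log (σ.toFun a).card).sum := by
  rw [h.card_onWord hL]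
  induction w with
  | nil => simp
  | cons a w ih =>
    simp only [List.map_cons, List.prod_cons, List.sum_cons, ← ih]
    rw [Nat.cast_mul]
    refine Real.log_mul ?_ ?_
    · exact_mod_cast (Finset.card_pos.2 (σ.nonempty' a)).ne'
    · rw [← h.card_onWord hL]
      exact_mod_cast (Finset.card_pos.2 (σ.onWord_nonempty w)).ne'

/-- A word inside `σ(v)` lies inside `σ(v')` with `v'` not much longer than necessary. -/
theorem Inflates.exists_short_of_prefix {σ : RandomSubstitution A} {μ l₁ : ℝ}
    (h : σ.Inflates L μ) (hL : ∀ a, 0 < L a) (hl₁ : ∀ a, L a ≤ l₁) (hμ : 0 ≤ μ) {v z w : List A}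
    (hv : v ≠ []) (hz : z ∈ σ.onWord v) (hw : w <+: z) :
    ∃ v', ∃ z' ∈ σ.onWord v', w <+: z' ∧ μ * geomLength L v' ≤ geomLength L w + μ * l₁ := by
  induction v generalizing z w with
  | nil => exact absurd rfl hv
  | cons b v ih =>
    obtain ⟨u, hu, z, hz', rfl⟩ := mem_onWord_cons.1 hz
    replace hz := hz'
    rcases prefix_append_cases hw with hw | ⟨t, rfl, ht⟩
    · refine ⟨[b], u, mem_onWord_singleton.2 hu, hw, ?_⟩
      rw [geomLength_singleton]
      nlinarith [geomLength_nonneg hL w, hl₁ b]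
    · by_cases hv : v = []
      · subst hv
        rw [mem_onWord_nil.1 hz, List.prefix_nil] at ht
        subst ht
        refine ⟨[b], u, mem_onWord_singleton.2 hu, by simp, ?_⟩
        rw [geomLength_singleton]
        nlinarith [geomLength_nonneg hL (u ++ []), hl₁ b]
      · obtain ⟨v', z', hz', htz, hle⟩ := ih hv hz ht
        refine ⟨b :: v', u ++ z', mem_onWord_cons.2 ⟨u, hu, z', hz', rfl⟩,
          (List.prefix_append_right_inj u).2 htz, ?_⟩
        -- Here `u` lies entirely inside the given prefix and has length exactly `μ * L b`, so the
        -- letter `b` adds no error; only the last letter used costs `μ * l₁`.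
        rw [geomLength_cons, geomLength_append, mul_add, h b u hu]
        linarith

/-- Only the letters whose images are cut at the two ends of `w` are wasted, each costing at most `μ
* l₁`. -/
theorem Inflates.exists_short_of_infix {σ : RandomSubstitution A} {μ l₁ : ℝ}
    (h : σ.Inflates L μ) (hL : ∀ a, 0 < L a) (hl₁ : ∀ a, L a ≤ l₁) (hμ : 0 ≤ μ) {v z w : List A}
    (hv : v ≠ []) (hz : z ∈ σ.onWord v) (hw : w <:+: z) :
    ∃ v', ∃ z' ∈ σ.onWord v', w <:+: z' ∧
      μ * geomLength L v' ≤ geomLength L w + 2 * (μ * l₁) := by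
  induction v generalizing z w with
  | nil => exact absurd rfl hv
  | cons b v ih =>
    have hb : 0 < L b := hL b
    have hbl := hl₁ b
    have hμl : 0 ≤ μ * l₁ := by nlinarith
    have hμb : μ * L b ≤ μ * l₁ := by gcongr
    obtain ⟨u, hu, z, hz', rfl⟩ := mem_onWord_cons.1 hz
    replace hz := hz'
    have single : w <:+: u → ∃ v', ∃ z' ∈ σ.onWord v', w <:+: z' ∧
        μ * geomLength L v' ≤ geomLength L w + 2 * (μ * l₁) := fun hw => by
      refine ⟨[b], u, mem_onWord_singleton.2 hu, hw, ?_⟩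
      rw [geomLength_singleton]
      linarith [geomLength_nonneg hL w]
    by_cases hv : v = []
    · subst hv
      rw [mem_onWord_nil.1 hz, List.append_nil] at hw
      exact single hw
    rcases List.infix_append_iff.1 hw with hw | hw | ⟨s, t, rfl, hs, ht⟩
    · exact single hw
    · exact ih hv hz hw
    · obtain ⟨v', z', hz', htz, hle⟩ := h.exists_short_of_prefix hL hl₁ hμ hv hz ht
      refine ⟨b :: v', u ++ z', mem_onWord_cons.2 ⟨u, hu, z', hz', rfl⟩, ?_, ?_⟩
      · exact List.infix_append_iff.2 (Or.inr (Or.inr ⟨s, t, rfl, hs, htz⟩))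
      · rw [geomLength_cons, geomLength_append]
        linarith [geomLength_nonneg hL s]

end GeomLength

end RandomSubstitution

namespace RandomSubstitution

theorem exists_length_bounds {A : Type*} [Finite A] [Nonempty A] {L : A → ℝ} (hL : ∀ a, 0 < L a) :
    ∃ l₀ l₁ : ℝ, 0 < l₀ ∧ (∀ a, l₀ ≤ L a) ∧ ∀ a, L a ≤ l₁ := by
  obtain ⟨b, hb⟩ := Finite.exists_min L
  obtain ⟨c, hc⟩ := Finite.exists_max L
  exact ⟨L b, L c, hL b, hb, hc⟩

/-! ### Consequences of primitivity -/

section Primitive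

variable {A : Type*} [Fintype A] [DecidableEq A] {L : A → ℝ}

theorem count_flatMap (θ : A → List A) (a : A) (w : List A) :
    ((w.flatMap θ).count a : ℝ) = ∑ c, substMatrix θ a c * (w.count c : ℝ) := by
  induction w with
  | nil => simp
  | cons b w ih =>
    rw [List.flatMap_cons, List.count_append, Nat.cast_add, ih, add_comm]
    simp only [List.count_cons, Nat.cast_add, mul_add, Finset.sum_add_distrib]
    congr 1
    simp [substMatrix]

/-- A primitive random substitution has a power with a marginal all of whose images contain
every letter. -/
theorem IsPrimitive.exists_marginal {ϑ : RandomSubstitution A} (h : ϑ.IsPrimitive) :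
    ∃ N : ℕ, ∃ θ : A → List A, (ϑ.pow N).IsMarginal θ ∧ ∀ a b, a ∈ θ b := by
  obtain ⟨n, -, θ, hθ, -, k, -, hpos⟩ := h
  -- Composing marginals multiplies substitution matrices, so powers of the matrix of `θ` belong to
  -- marginals of higher powers of `ϑ`.
  have key : ∀ k : ℕ, ∃ θ' : A → List A, (ϑ.pow (k * n)).IsMarginal θ' ∧
      ∀ a b, ((θ' b).count a : ℝ) = (substMatrix θ ^ k) a b := by
    intro k
    induction k with
    | zero =>
      refine ⟨fun b => [b], fun b => ?_, fun a b => ?_⟩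
      · rw [zero_mul]; exact Finset.mem_singleton_self _
      · rw [List.count_singleton, pow_zero, Matrix.one_apply]
        by_cases h : a = b
        · simp [h]
        · simp [h, Ne.symm h]
    | succ k ih =>
      obtain ⟨θ', hθ', hc⟩ := ih
      refine ⟨fun b => (θ' b).flatMap θ, fun b => ?_, fun a b => ?_⟩
      · rw [add_mul, one_mul]
        exact mem_pow_add.2 ⟨θ' b, hθ' b, flatMap_mem_onWord hθ _⟩
      · rw [count_flatMap, pow_succ', Matrix.mul_apply]
        simp only [hc]
  obtain ⟨θ', hθ', hc⟩ := key k
  refine ⟨k * n, θ', hθ', fun a b => ?_⟩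
  have := hpos a b
  rw [← hc] at this
  exact List.count_pos_iff.1 (by exact_mod_cast this)

/-- Every letter occurs in the interior of some inflation word of positive level. -/
theorem exists_interior {ϑ : RandomSubstitution A} (hprim : ϑ.IsPrimitive) {lam : ℝ}
    (hgeom : ϑ.IsGeomCompatible lam L) (a : A) :
    ∃ (N : ℕ) (b : A) (u u' : List A), 0 < N ∧ u ≠ [] ∧ u' ≠ [] ∧
      u ++ [a] ++ u' ∈ (ϑ.pow N).toFun b := by
  have : Nonempty A := ⟨a⟩
  obtain ⟨N, θ, hθ, hmem⟩ := hprim.exists_marginal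
  obtain ⟨l₀, l₁, hl₀, h₀, h₁⟩ := exists_length_bounds hgeom.pos
  -- This level makes the words long enough to have three letters; using `j + 1` in place of `j`
  -- keeps the final level positive.
  obtain ⟨j, hj⟩ := pow_unbounded_of_one_lt (3 * l₁ / L a) hgeom.one_lt
  obtain ⟨v, hv⟩ := (ϑ.pow (j + 1)).nonempty' a
  have hlen : 3 ≤ v.length := by
    have e1 := hgeom.inflates.pow (j + 1) a v hv
    have e2 := geomLength_le_mul_length h₁ v
    have e3 : 3 * l₁ < lam ^ j * L a := by rwa [div_lt_iff₀ (hgeom.pos a)] at hj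
    have e4 : lam ^ j * L a ≤ lam ^ (j + 1) * L a := by
      have := hgeom.pos a
      gcongr
      · exact hgeom.one_lt.le
      · omega
    have hl₁ : 0 < l₁ := (hgeom.pos a).trans_le (h₁ a)
    have : 3 * l₁ < v.length * l₁ := by linarith
    have := lt_of_mul_lt_mul_right this hl₁.le
    exact_mod_cast this.le
  match v, hlen with
  | x :: y :: z :: t, _ =>
    -- The image of the middle letter `y` contains `a`, and the non-empty images of its neighbours
    -- put `a` in the interior.
    obtain ⟨p, p', hp⟩ := List.append_of_mem (hmem a y)
    have hne : ∀ c, θ c ≠ [] := fun c hc => by simpa [hc] using hmem c c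
    refine ⟨j + 1 + N, a, θ x ++ p, p' ++ (z :: t).flatMap θ, by omega, by simp [hne],
      by simp [hne], ?_⟩
    refine mem_pow_add.2 ⟨_, hv, ?_⟩
    have := flatMap_mem_onWord hθ (x :: y :: z :: t)
    simpa [hp] using this

/-- Inflation words extend on both sides to inflation words of higher level. -/
theorem exists_extension {ϑ : RandomSubstitution A} (hprim : ϑ.IsPrimitive) {lam : ℝ}
    (hgeom : ϑ.IsGeomCompatible lam L) (K m : ℕ) {a : A} {w : List A}
    (hw : w ∈ (ϑ.pow m).toFun a) :
    ∃ (m' : ℕ) (b : A) (p p' : List A), m + K ≤ m' ∧ K ≤ p.length ∧ K ≤ p'.length ∧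
      p ++ w ++ p' ∈ (ϑ.pow m').toFun b := by
  induction K with
  | zero => exact ⟨m, a, [], [], by simp, by simp, by simp, by simpa using hw⟩
  | succ K ih =>
    obtain ⟨m', b, p, p', hm, hp, hp', h⟩ := ih
    -- Apply level `m'` to a word with `b` in its interior, realising `b` by the word already built:
    -- the flanks gain at least one letter on each side.
    obtain ⟨N, c, u, u', hN, hu, hu', hmem⟩ := exists_interior hprim hgeom b
    obtain ⟨x, hx⟩ := (ϑ.pow m').onWord_nonempty u
    obtain ⟨x', hx'⟩ := (ϑ.pow m').onWord_nonempty u'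
    have h1 := List.length_pos_of_ne_nil (ne_nil_of_mem_onWord _ hu hx)
    have h2 := List.length_pos_of_ne_nil (ne_nil_of_mem_onWord _ hu' hx')
    refine ⟨N + m', c, x ++ p, p' ++ x', by omega, by simp; omega, by simp; omega, ?_⟩
    refine mem_pow_add.2 ⟨_, hmem, ?_⟩
    refine mem_onWord_append.2 ⟨x ++ (p ++ w ++ p'), mem_onWord_append.2
      ⟨x, hx, _, mem_onWord_singleton.2 h, rfl⟩, x', hx', by simp⟩

/-- A legal word may come from a level below `m`. Extending the surrounding inflation word raises
the level to at least `m`, after which its last `m` steps can be split off. -/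
theorem exists_infix_onWord {ϑ : RandomSubstitution A} (hprim : ϑ.IsPrimitive) {lam : ℝ}
    (hgeom : ϑ.IsGeomCompatible lam L) (m : ℕ) {w : List A} (hw : w ∈ ϑ.language) :
    ∃ v, v ≠ [] ∧ ∃ z ∈ (ϑ.pow m).onWord v, w <:+: z := by
  obtain ⟨-, n, a, z, hz, hwz⟩ := hw
  obtain ⟨m', b, p, p', hm, -, -, h⟩ := exists_extension hprim hgeom m n hz
  obtain ⟨k, rfl⟩ : ∃ k, m' = k + m := ⟨m' - m, by omega⟩
  obtain ⟨v, hv, hv'⟩ := mem_pow_add.1 h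
  exact ⟨v, (ϑ.pow k).ne_nil' b v hv, _, hv', hwz.trans (List.infix_append ..)⟩

end Primitive

/-! ### Counting legal words through level-`m` inflation words -/

section Counting

/-- The words of length at most `r`. -/
def wordsUpTo (A : Type*) [Fintype A] [DecidableEq A] (r : ℕ) : Finset (List A) :=
  (Finset.range (r + 1)).biUnion fun i => Finset.univ.image (List.ofFn : (Fin i → A) → List A)

/-- The subwords of a word. -/
def infixes {A : Type*} [DecidableEq A] (z : List A) : Finset (List A) :=
  (Finset.range (z.length + 1) ×ˢ Finset.range (z.length + 1)).image
    fun p => (z.drop p.1).take p.2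

theorem mem_infixes {A : Type*} [DecidableEq A] {w z : List A} (h : w <:+: z) : w ∈ infixes z := by
  obtain ⟨s, t, rfl⟩ := h
  refine Finset.mem_image.2 ⟨(s.length, w.length), ?_, ?_⟩
  · simp; omega
  · simp

theorem card_infixes_le {A : Type*} [DecidableEq A] (z : List A) : (infixes z).card ≤ (z.length + 1) ^ 2 := by
  refine Finset.card_image_le.trans ?_
  rw [Finset.card_product, Finset.card_range, sq]

variable {A : Type*} [Fintype A] [DecidableEq A] {L : A → ℝ}

theorem mem_wordsUpTo {r : ℕ} {w : List A} (h : w.length ≤ r) : w ∈ wordsUpTo A r :=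
  Finset.mem_biUnion.2 ⟨w.length, Finset.mem_range.2 (by omega),
    Finset.mem_image.2 ⟨w.get, Finset.mem_univ _, List.ofFn_get w⟩⟩

theorem card_wordsUpTo_le [Nonempty A] (r : ℕ) :
    (wordsUpTo A r).card ≤ (r + 1) * Fintype.card A ^ r := by
  refine (Finset.card_biUnion_le_card_mul _ _ (Fintype.card A ^ r) fun i hi => ?_).trans (by simp)
  refine Finset.card_image_le.trans ?_
  rw [Finset.card_univ, Fintype.card_fun, Fintype.card_fin]
  exact Nat.pow_le_pow_right Fintype.card_pos (by simpa [Nat.lt_succ_iff] using hi)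

/-- Counting legal words of bounded geometric length by means of level-`m` inflation words. -/
theorem card_language_le {ϑ : RandomSubstitution A} (hprim : ϑ.IsPrimitive) {lam : ℝ}
    (hgeom : ϑ.IsGeomCompatible lam L) (m : ℕ) {l₀ l₁ H ℓ : ℝ} (hl₀ : 0 < l₀)
    (h₀ : ∀ a, l₀ ≤ L a) (h₁ : ∀ a, L a ≤ l₁) (hH : 0 ≤ H)
    (hcard : ∀ b, Real.log ((ϑ.pow m).toFun b).card ≤ H * (lam ^ m * L b)) [Nonempty A]
    (hℓ : 0 ≤ ℓ) {W : Finset (List A)} (hW : ∀ w ∈ W, w ∈ ϑ.language ∧ geomLength L w ≤ ℓ) :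
    (W.card : ℝ) ≤ ((ℓ / lam ^ m + 2 * l₁) / l₀ + 1)
      * Real.exp (Real.log (Fintype.card A) * ((ℓ / lam ^ m + 2 * l₁) / l₀))
      * (Real.exp (H * (ℓ + 2 * (lam ^ m * l₁))) * ((ℓ + 2 * (lam ^ m * l₁)) / l₀ + 1) ^ 2) := by
  set μ := lam ^ m with hμdef
  have hμ : 0 < μ := pow_pos (zero_lt_one.trans hgeom.one_lt) m
  have hl₁ : 0 < l₁ := hl₀.trans_le ((h₀ (Classical.arbitrary A)).trans (h₁ _))
  set R := ℓ + 2 * (μ * l₁) with hR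
  have hR0 : 0 ≤ R := by positivity
  have hRμ : ℓ / μ + 2 * l₁ = R / μ := by rw [hR]; field_simp
  rw [hRμ]
  have hinf := hgeom.inflates.pow m
  -- A bound on the number of letters of `v`, from `μ * l₀ * |v| ≤ μ * L(v) ≤ R`.
  set r := ⌊R / μ / l₀⌋₊
  have hr : (r : ℝ) ≤ R / μ / l₀ := Nat.floor_le (by positivity)
  set V := (wordsUpTo A r).filter fun v => μ * geomLength L v ≤ R
  have hsub : W ⊆ V.biUnion fun v => ((ϑ.pow m).onWord v).biUnion infixes := by
    intro w hw
    obtain ⟨hlang, hwl⟩ := hW w hw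
    obtain ⟨v, hv, z, hz, hwz⟩ := exists_infix_onWord hprim hgeom m hlang
    obtain ⟨v', z', hz', hwz', hle⟩ :=
      hinf.exists_short_of_infix hgeom.pos h₁ hμ.le hv hz hwz
    have hle' : μ * geomLength L v' ≤ R := hle.trans (by rw [hR]; linarith)
    refine Finset.mem_biUnion.2 ⟨v', Finset.mem_filter.2 ⟨mem_wordsUpTo ?_, hle'⟩,
      Finset.mem_biUnion.2 ⟨z', hz', mem_infixes hwz'⟩⟩
    refine Nat.le_floor ?_
    rw [le_div_iff₀ hl₀, le_div_iff₀ hμ]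
    nlinarith [mul_length_le_geomLength h₀ v']
  have hpart : ∀ v ∈ V, ((((ϑ.pow m).onWord v).biUnion infixes).card : ℝ) ≤
      Real.exp (H * R) * (R / l₀ + 1) ^ 2 := by
    intro v hv
    have hvR := (Finset.mem_filter.1 hv).2
    have hone : (0 : ℝ) < ((ϑ.pow m).onWord v).card := by
      exact_mod_cast Finset.card_pos.2 ((ϑ.pow m).onWord_nonempty v)
    -- Additivity of the logarithmic count turns the letterwise bound `hcard` into `H` times the
    -- inflated length of `v`.
    have e1 : (((ϑ.pow m).onWord v).card : ℝ) ≤ Real.exp (H * R) := by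
      rw [← Real.log_le_iff_le_exp hone, hinf.log_card_onWord hgeom.pos]
      calc (v.map fun a => Real.log ((ϑ.pow m).toFun a).card).sum
          ≤ (v.map fun a => H * μ * L a).sum :=
            List.sum_le_sum fun b _ => (hcard b).trans_eq (by ring)
        _ = H * (μ * geomLength L v) := by
            rw [List.sum_map_mul_left, geomLength_eq_sum_map]; ring
        _ ≤ H * R := by gcongr
    have e2 : ∀ z ∈ (ϑ.pow m).onWord v, ((infixes z).card : ℝ) ≤ (R / l₀ + 1) ^ 2 := by
      intro z hz
      refine (Nat.cast_le.2 (card_infixes_le z)).trans ?_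
      push_cast
      have : (z.length : ℝ) ≤ R / l₀ := by
        rw [le_div_iff₀ hl₀]
        have := mul_length_le_geomLength h₀ z
        rw [hinf.onWord hz] at this
        linarith
      gcongr
    calc ((((ϑ.pow m).onWord v).biUnion infixes).card : ℝ)
        ≤ ∑ z ∈ (ϑ.pow m).onWord v, ((infixes z).card : ℝ) := by
          exact_mod_cast Finset.card_biUnion_le
      _ ≤ ((ϑ.pow m).onWord v).card * (R / l₀ + 1) ^ 2 := by
          rw [← nsmul_eq_mul]; exact Finset.sum_le_card_nsmul _ _ _ e2
      _ ≤ _ := by gcongr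
  -- A crude count of all words suffices: its exponential rate in `ℓ` carries the factor `1 / μ`,
  -- which tends to zero with growing level.
  have hVcard : (V.card : ℝ) ≤
      (R / μ / l₀ + 1) * Real.exp (Real.log (Fintype.card A) * (R / μ / l₀)) := by
    have hA : (1 : ℝ) ≤ Fintype.card A := by exact_mod_cast Fintype.card_pos
    calc (V.card : ℝ) ≤ ((r + 1) * Fintype.card A ^ r : ℕ) :=
          Nat.cast_le.2 ((Finset.card_filter_le _ _).trans (card_wordsUpTo_le r))
      _ = (r + 1) * (Fintype.card A : ℝ) ^ (r : ℝ) := by push_cast; rw [Real.rpow_natCast]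
      _ = (r + 1) * Real.exp (Real.log (Fintype.card A) * r) := by
          rw [Real.rpow_def_of_pos (by linarith)]
      _ ≤ _ := by
          have := Real.log_nonneg hA
          gcongr
  calc (W.card : ℝ) ≤ ((V.biUnion fun v => ((ϑ.pow m).onWord v).biUnion infixes).card : ℝ) :=
        Nat.cast_le.2 (Finset.card_le_card hsub)
    _ ≤ ∑ v ∈ V, ((((ϑ.pow m).onWord v).biUnion infixes).card : ℝ) := by
        exact_mod_cast Finset.card_biUnion_le
    _ ≤ V.card * (Real.exp (H * R) * (R / l₀ + 1) ^ 2) := by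
        rw [← nsmul_eq_mul]; exact Finset.sum_le_card_nsmul _ _ _ hpart
    _ ≤ _ := by gcongr

end Counting

end RandomSubstitution

namespace RandomSubstitution

/-! ### Windows, compactness and realisation of inflation words -/

section Window

variable {A : Type*}

@[simp] theorem length_window (x : ℤ → A) (i : ℤ) (n : ℕ) : (window x i n).length = n := by
  simp [window]

theorem window_eq_iff {x y : ℤ → A} {i j : ℤ} {n : ℕ} :
    window x i n = window y j n ↔ ∀ k : ℕ, k < n → x (i + k) = y (j + k) := by
  unfold window
  rw [List.ofFn_inj, funext_iff]
  exact ⟨fun h k hk => h ⟨k, hk⟩, fun h k => h k k.2⟩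

theorem window_succ (x : ℤ → A) (i : ℤ) (n : ℕ) :
    window x i (n + 1) = window x i n ++ [x (i + n)] := by
  unfold window
  rw [List.ofFn_succ_last]
  simp

theorem window_shift (x : ℤ → A) (i j : ℤ) (n : ℕ) :
    window (fun k => x (k + j)) i n = window x (i + j) n := by
  rw [window_eq_iff]
  intro k _
  congr 1
  ring

theorem window_eq_take_drop {x : ℤ → A} {z : List A} {c : ℕ}
    (hx : ∀ k : ℕ, (h : k < z.length) → x (k - c) = z[k]) {i n : ℕ} (h : i + n ≤ z.length) :
    window x (i - c) n = (z.drop i).take n := by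
  apply List.ext_getElem
  · simp; omega
  · intro k hk _
    simp only [length_window] at hk
    have := hx (i + k) (by omega)
    simp only [window, List.getElem_ofFn, List.getElem_take, List.getElem_drop, ← this]
    congr 1
    push_cast
    ring

theorem isClosed_window_mem [TopologicalSpace A] [DiscreteTopology A] (i : ℤ) (n : ℕ)
    (s : Set (List A)) : IsClosed {x : ℤ → A | window x i n ∈ s} := by
  have hc : Continuous fun (x : ℤ → A) (k : Fin n) => x (i + (k : ℕ)) := by fun_prop
  exact (isClosed_discrete {f : Fin n → A | List.ofFn f ∈ s}).preimage hc

theorem isClosed_subshift [DecidableEq A] [TopologicalSpace A] [DiscreteTopology A]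
    (ϑ : RandomSubstitution A) : IsClosed ϑ.subshift := by
  have : ϑ.subshift = ⋂ (i : ℤ) (n : ℕ) (_ : 0 < n), {x | window x i n ∈ ϑ.language} := by
    ext x; simp [subshift]
  rw [this]
  exact isClosed_iInter fun i => isClosed_iInter fun n => isClosed_iInter fun _ =>
    isClosed_window_mem i n _

theorem compactSpace_subshift [Finite A] [DecidableEq A] [TopologicalSpace A]
    [DiscreteTopology A] (ϑ : RandomSubstitution A) : CompactSpace ϑ.subshift :=
  isCompact_iff_compactSpace.1 (isClosed_subshift ϑ).isCompact

theorem shift_surjective [DecidableEq A] (ϑ : RandomSubstitution A) :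
    Function.Surjective ϑ.shift := by
  intro x
  refine ⟨⟨fun k => x.1 (k + -1), fun i n hn => ?_⟩, ?_⟩
  · rw [window_shift]; exact x.2 _ n hn
  · apply Subtype.ext
    funext k
    simp [shift]

theorem shift_iterate_apply [DecidableEq A] (ϑ : RandomSubstitution A) (x : ϑ.subshift) (j : ℕ)
    (k : ℤ) : (ϑ.shift^[j] x).1 k = x.1 (k + j) := by
  induction j generalizing x with
  | zero => simp
  | succ j ih =>
    rw [Function.iterate_succ_apply, ih]
    exact congrArg x.1 (by push_cast; ring)

/-- Every inflation word is a window of an element of the subshift. -/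
theorem exists_window_eq [Fintype A] [DecidableEq A] {L : A → ℝ}
    {ϑ : RandomSubstitution A} (hprim : ϑ.IsPrimitive) {lam : ℝ}
    (hgeom : ϑ.IsGeomCompatible lam L) {m : ℕ} {a : A} {w : List A}
    (hw : w ∈ (ϑ.pow m).toFun a) : ∃ x : ϑ.subshift, window x.1 0 w.length = w := by
  let _ : TopologicalSpace A := ⊥
  have : DiscreteTopology A := ⟨rfl⟩
  -- Sequences showing `w` at the origin and legal on `[-K, K)`. These form a decreasing sequence of
  -- non-empty compact sets, and a common point is legal everywhere.
  let C : ℕ → Set (ℤ → A) := fun K => {x | window x 0 w.length = w ∧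
    ∀ (i : ℤ) (n : ℕ), 0 < n → -K ≤ i → i + n ≤ K → window x i n ∈ ϑ.language}
  have hclosed : ∀ K, IsClosed (C K) := by
    intro K
    have : C K = {x | window x 0 w.length ∈ ({w} : Set (List A))} ∩ ⋂ (i : ℤ) (n : ℕ) (_ : 0 < n)
        (_ : -(K : ℤ) ≤ i) (_ : i + n ≤ K), {x | window x i n ∈ ϑ.language} := by
      ext x; simp [C]
    rw [this]
    exact (isClosed_window_mem 0 _ _).inter <| isClosed_iInter fun i => isClosed_iInter fun n =>
      isClosed_iInter fun _ => isClosed_iInter fun _ => isClosed_iInter fun _ =>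
        isClosed_window_mem i n _
  have hne : ∀ K, (C K).Nonempty := by
    intro K
    obtain ⟨m', b, p, p', -, hp, hp', h⟩ := exists_extension hprim hgeom K m hw
    set z := p ++ w ++ p' with hz
    have hlen : z.length = p.length + w.length + p'.length := by simp [z]; omega
    -- The word `z` is laid out with `w` starting at the origin. Values beyond `z` are irrelevant,
    -- since every window tested stays inside it.
    let x : ℤ → A := fun k => z.getD (k + p.length).toNat a
    have hx : ∀ k : ℕ, (h : k < z.length) → x (k - p.length) = z[k] := by
      intro k hk
      have : ((k : ℤ) - p.length + p.length).toNat = k := by omega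
      simp only [x, this]
      exact List.getD_eq_getElem _ _ hk
    refine ⟨x, ?_, fun i n hn hi hin => ?_⟩
    · have := window_eq_take_drop hx (i := p.length) (n := w.length) (by omega)
      rw [sub_self] at this
      rw [this, hz]
      simp
    · obtain ⟨j, hj⟩ : ∃ j : ℕ, i = j - p.length := ⟨(i + p.length).toNat, by omega⟩
      have := window_eq_take_drop hx (i := j) (n := n) (by omega)
      rw [hj]
      refine ⟨fun h0 => ?_, m', b, z, h, ?_⟩
      · have := congrArg List.length h0
        simp at this
        omega
      · rw [this]
        exact (List.take_prefix _ _).isInfix.trans (List.drop_suffix _ _).isInfix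
  obtain ⟨x, hx⟩ := IsCompact.nonempty_iInter_of_sequence_nonempty_isCompact_isClosed C
    (fun K x hx => ⟨hx.1, fun i n hn hi hin => hx.2 i n hn (by push_cast; omega)
      (by push_cast; omega)⟩) hne (hclosed 0).isCompact hclosed
  rw [mem_iInter] at hx
  refine ⟨⟨x, fun i n hn => ?_⟩, (hx 0).1⟩
  exact (hx (i.natAbs + n)).2 i n hn (by omega) (by omega)

end Window

/-! ### Tile positions in the tiling of the line -/

section TilePos

variable {A : Type*} {L : A → ℝ}

/-- The position of the left end of the `k`-th tile in the tiling of `ℝ` associated with `x`,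
when the `0`-th tile starts at the origin. -/
noncomputable def tilePos (L : A → ℝ) (x : ℤ → A) (k : ℤ) : ℝ :=
  ∑ i ∈ Finset.Ico 0 k, L (x i) - ∑ i ∈ Finset.Ico k 0, L (x i)

@[simp] theorem tilePos_zero (x : ℤ → A) : tilePos L x 0 = 0 := by simp [tilePos]

theorem tilePos_add_one (x : ℤ → A) (k : ℤ) : tilePos L x (k + 1) = tilePos L x k + L (x k) := by
  unfold tilePos
  rcases le_or_gt 0 k with hk | hk
  · have h1 : Finset.Ico 0 (k + 1) = insert k (Finset.Ico 0 k) := by ext; simp; omega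
    have h2 : Finset.Ico (k + 1) 0 = ∅ := by ext; simp; omega
    have h3 : Finset.Ico k 0 = ∅ := by ext; simp; omega
    rw [h1, h2, h3, Finset.sum_insert (by simp)]
    simp [add_comm]
  · have h1 : Finset.Ico k 0 = insert k (Finset.Ico (k + 1) 0) := by ext; simp; omega
    have h2 : Finset.Ico 0 (k + 1) = ∅ := by ext; simp; omega
    have h3 : Finset.Ico 0 k = ∅ := by ext; simp; omega
    rw [h1, h2, h3, Finset.sum_insert (by simp)]
    simp

theorem tilePos_shift (x : ℤ → A) (k : ℤ) :
    tilePos L (fun i => x (i + 1)) k = tilePos L x (k + 1) - L (x 0) := by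
  induction k using Int.induction_on with
  | zero => rw [tilePos_add_one]; simp
  | succ n ih => rw [tilePos_add_one, ih, tilePos_add_one x (n + 1)]; ring
  | pred n ih =>
    have h1 := tilePos_add_one (L := L) (fun i => x (i + 1)) (-n - 1)
    have h2 := tilePos_add_one (L := L) x (-n - 1 + 1)
    rw [sub_add_cancel] at h1 h2
    rw [sub_add_cancel]
    linarith

theorem tilePos_natCast [Fintype A] [DecidableEq A] (x : ℤ → A) (n : ℕ) :
    tilePos L x n = geomLength L (window x 0 n) := by
  induction n with
  | zero => simp [window]
  | succ n ih => rw [window_succ, geomLength_append, ← ih]; push_cast; simp [tilePos_add_one]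

theorem mul_sub_le_tilePos_sub {l₀ : ℝ} (h₀ : ∀ a, l₀ ≤ L a) (x : ℤ → A) {j k : ℤ} (h : j ≤ k) :
    l₀ * (k - j) ≤ tilePos L x k - tilePos L x j := by
  induction k, h using Int.leInduction with
  | base => simp
  | succ k _ ih => rw [tilePos_add_one]; push_cast; linarith [h₀ (x k)]

theorem tilePos_mono (hL : ∀ a, 0 < L a) (x : ℤ → A) : Monotone (tilePos L x) := fun j k h => by
  have := mul_sub_le_tilePos_sub (fun a => (hL a).le) x h
  linarith

theorem tilePos_congr {x y : ℤ → A} {j : ℕ} (h : ∀ k : ℕ, k < j → x k = y k) :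
    tilePos L x j = tilePos L y j := by
  induction j with
  | zero => simp
  | succ j ih =>
    push_cast
    rw [tilePos_add_one, tilePos_add_one, ih fun k hk => h k (by omega), h j (by omega)]

theorem continuous_tilePos [TopologicalSpace A] [DiscreteTopology A] (k : ℤ) :
    Continuous fun x : ℤ → A => tilePos L x k := by
  have : Continuous L := continuous_of_discreteTopology
  unfold tilePos
  fun_prop

end TilePos

/-! ### Tent functions detecting the type of a tile -/

section Tent

variable {A : Type*} {L : A → ℝ}

open Classical in
/-- The contribution of the `k`-th tile to `tent`. -/
noncomputable def tentTerm (L : A → ℝ) (b : A) (k : ℤ) (p : (ℤ → A) × ℝ) : ℝ :=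
  (if p.1 k = b then 1 else 0) *
    max 0 (min (p.2 - tilePos L p.1 k) (tilePos L p.1 (k + 1) - p.2))

/-- The distance from `s` to the boundary of the tile of `x` around `s` if this tile is of
type `b`, and zero otherwise. -/
noncomputable def tent (L : A → ℝ) (b : A) (p : (ℤ → A) × ℝ) : ℝ :=
  ∑ᶠ k : ℤ, tentTerm L b k p

theorem tentTerm_ne_zero {b : A} {k : ℤ} {p : (ℤ → A) × ℝ} (h : tentTerm L b k p ≠ 0) :
    tilePos L p.1 k < p.2 ∧ p.2 < tilePos L p.1 (k + 1) := by
  by_contra hc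
  apply h
  unfold tentTerm
  rw [max_eq_left, mul_zero]
  rw [min_le_iff, sub_nonpos, sub_nonpos]
  by_contra! h'
  exact hc h'

theorem tentTerm_shift (b : A) (k : ℤ) (x : ℤ → A) (s : ℝ) :
    tentTerm L b k (fun i => x (i + 1), s) = tentTerm L b (k + 1) (x, s + L (x 0)) := by
  unfold tentTerm
  simp only [tilePos_shift]
  congr 3 <;> ring

/-- Shifting the sequence relabels the tiles without moving them relative to the marked point; this
invariance lets `tent` descend to the suspension. -/
theorem tent_shift (b : A) (x : ℤ → A) (s : ℝ) :
    tent L b (fun i => x (i + 1), s) = tent L b (x, s + L (x 0)) := by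
  unfold tent
  simp only [tentTerm_shift]
  exact finsum_comp_equiv (Equiv.addRight (1 : ℤ)) (f := fun k => tentTerm L b k (x, s + L (x 0)))

theorem tent_eq (hL : ∀ a, 0 < L a) (b : A) {x : ℤ → A} {s : ℝ} {j : ℤ}
    (h1 : tilePos L x j < s) (h2 : s < tilePos L x (j + 1)) :
    tent L b (x, s) = tentTerm L b j (x, s) := by
  refine finsum_eq_single _ _ fun k hk => ?_
  by_contra h
  obtain ⟨h3, h4⟩ := tentTerm_ne_zero h
  simp only at h3 h4
  rcases lt_or_gt_of_ne hk with hk | hk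
  · linarith [tilePos_mono hL x (show k + 1 ≤ j by omega)]
  · linarith [tilePos_mono hL x (show j + 1 ≤ k by omega)]

theorem continuous_tent [TopologicalSpace A] [DiscreteTopology A] {l₀ : ℝ} (hl₀ : 0 < l₀)
    (h₀ : ∀ a, l₀ ≤ L a) (b : A) : Continuous (tent L b) := by
  classical
  refine continuous_finsum (fun k => ?_) fun p => ?_
  · have hg : Continuous fun c : A => if c = b then (1 : ℝ) else 0 := continuous_of_discreteTopology
    have h1 : Continuous fun p : (ℤ → A) × ℝ => if p.1 k = b then (1 : ℝ) else 0 :=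
      hg.comp ((continuous_apply k).comp continuous_fst)
    have h2 := (continuous_tilePos (L := L) k).comp (continuous_fst (X := ℤ → A) (Y := ℝ))
    have h3 := (continuous_tilePos (L := L) (k + 1)).comp (continuous_fst (X := ℤ → A) (Y := ℝ))
    have : tentTerm L b k = fun p => (if p.1 k = b then (1 : ℝ) else 0) *
      max 0 (min (p.2 - tilePos L p.1 k) (tilePos L p.1 (k + 1) - p.2)) := by
        funext p; unfold tentTerm; congr
    rw [this]
    exact h1.mul (continuous_const.max ((continuous_snd.sub h2).min (h3.sub continuous_snd)))
  · refine ⟨Prod.snd ⁻¹' Metric.ball p.2 1,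
      continuous_snd.continuousAt.preimage_mem_nhds (Metric.ball_mem_nhds _ one_pos), ?_⟩
    -- Local finiteness: tiles have length at least `l₀`, so only those with index in `[-M - 1, M]`
    -- can contain a height of absolute value below `|p.2| + 1`, whatever the sequence.
    set M := ⌈(|p.2| + 1) / l₀⌉₊
    have hM : (|p.2| + 1) / l₀ ≤ M := Nat.le_ceil _
    rw [div_le_iff₀ hl₀] at hM
    refine (Set.finite_Icc (-(M : ℤ) - 1) M).subset ?_
    rintro k ⟨q, hq, hqp⟩
    obtain ⟨h3, h4⟩ := tentTerm_ne_zero hq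
    simp only [mem_preimage, Metric.mem_ball, Real.dist_eq] at hqp
    have hq2 : |q.2| < |p.2| + 1 := by
      have := abs_sub_abs_le_abs_sub q.2 p.2
      linarith
    obtain ⟨hq3, hq4⟩ := abs_lt.1 hq2
    constructor
    · by_contra! hk
      have := mul_sub_le_tilePos_sub h₀ q.1 (show k + 1 ≤ 0 by omega)
      rw [tilePos_zero] at this
      have hk' : ((k : ℝ) + 1) ≤ -M := by exact_mod_cast (by omega : k + 1 ≤ -M)
      push_cast at this
      nlinarith
    · by_contra! hk
      have := mul_sub_le_tilePos_sub h₀ q.1 (show 0 ≤ k by omega)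
      rw [tilePos_zero] at this
      have hk' : (M : ℝ) ≤ k := by exact_mod_cast hk.le
      push_cast at this
      nlinarith

end Tent

end RandomSubstitution

namespace RandomSubstitution

/-! ### The geometric hull and separation of inflation words -/

section Hull

variable {A : Type*} [DecidableEq A] {L : A → ℝ}

/-- The space of the geometric hull. -/
abbrev HullSpace (ϑ : RandomSubstitution A) (L : A → ℝ) : Type _ :=
  Suspension ϑ.shift (fun x : ϑ.subshift => L (x.1 0))

/-- The point of the geometric hull represented by `(x, s)`. -/
def hullMk (ϑ : RandomSubstitution A) (L : A → ℝ) (p : ϑ.subshift × ℝ) : HullSpace ϑ L :=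
  Quot.mk _ p

theorem hullMk_shift {ϑ : RandomSubstitution A} (x : ϑ.subshift) (s : ℝ) :
    hullMk ϑ L (x, s + L (x.1 0)) = hullMk ϑ L (ϑ.shift x, s) :=
  Quot.sound ⟨x, s, rfl, rfl⟩

/-- The function induced by `tent` on the geometric hull. -/
noncomputable def hullTent (ϑ : RandomSubstitution A) (L : A → ℝ) (b : A) : HullSpace ϑ L → ℝ :=
  Quot.lift (fun p => tent L b (p.1.1, p.2)) (by
    rintro _ _ ⟨x, s, rfl, rfl⟩
    exact (tent_shift b x.1 s).symm)

theorem hullTent_hullMk {ϑ : RandomSubstitution A} (b : A) (x : ϑ.subshift) (s : ℝ) :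
    hullTent ϑ L b (hullMk ϑ L (x, s)) = tent L b (x.1, s) := rfl

/-- Distinct inflation words of the same geometric length have a first disagreement. -/
theorem exists_first_disagreement [Fintype A] (hL : ∀ a, 0 < L a) {x x' : ℤ → A} {n n' : ℕ}
    (hne : window x 0 n ≠ window x' 0 n')
    (hl : geomLength L (window x 0 n) = geomLength L (window x' 0 n')) :
    ∃ j : ℕ, (∀ k : ℕ, k < j → x k = x' k) ∧ x j ≠ x' j ∧
      tilePos L x (j + 1) ≤ geomLength L (window x 0 n) := by
  have hex : ∃ j : ℕ, j < n ∧ x j ≠ x' j := by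
    -- Agreement on the first `n` letters would make one word a prefix of the other, hence equal to
    -- it because the lengths agree.
    by_contra! h
    have hw : window x 0 n = window x' 0 n := by
      rw [window_eq_iff]; intro k hk; simpa using h k hk
    apply hne
    rw [hw] at hl ⊢
    rcases le_total n n' with hnn | hnn
    · refine eq_of_prefix_of_geomLength_eq hL ?_ hl
      have := window_eq_take_drop (x := x') (z := window x' 0 n') (c := 0)
        (fun k hk => by simp [window]) (i := 0) (n := n) (by simpa using hnn)
      simp only [Nat.cast_zero, sub_zero, List.drop_zero] at this
      rw [this]
      exact List.take_prefix _ _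
    · refine (eq_of_prefix_of_geomLength_eq hL ?_ hl.symm).symm
      have := window_eq_take_drop (x := x') (z := window x' 0 n) (c := 0)
        (fun k hk => by simp [window]) (i := 0) (n := n') (by simpa using hnn)
      simp only [Nat.cast_zero, sub_zero, List.drop_zero] at this
      rw [this]
      exact List.take_prefix _ _
  classical
  obtain ⟨hjn, hj⟩ := Nat.find_spec hex
  refine ⟨Nat.find hex, fun k hk => ?_, hj, ?_⟩
  · have := Nat.find_min hex hk
    by_contra h
    exact this ⟨hk.trans hjn, h⟩
  · rw [← tilePos_natCast]
    exact tilePos_mono hL x (by omega)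

variable [TopologicalSpace A]

theorem isQuotientMap_hullMk (ϑ : RandomSubstitution A) (L : A → ℝ) :
    IsQuotientMap (hullMk ϑ L) :=
  isQuotientMap_quot_mk

theorem geometricHull_hullMk {ϑ : RandomSubstitution A} (t : ℝ) (x : ϑ.subshift) (s : ℝ) :
    ϑ.geometricHull L t (hullMk ϑ L (x, s)) = hullMk ϑ L (x, s + t) := rfl

theorem geometricHull_iterate_hullMk {ϑ : RandomSubstitution A} (k : ℕ) (x : ϑ.subshift) (s : ℝ) :
    (ϑ.geometricHull L 1)^[k] (hullMk ϑ L (x, s)) = hullMk ϑ L (x, s + k) := by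
  induction k with
  | zero => simp
  | succ k ih =>
    rw [Function.iterate_succ_apply', ih, geometricHull_hullMk]
    push_cast
    rw [add_assoc]

theorem continuous_hullTent [DiscreteTopology A] (ϑ : RandomSubstitution A) {l₀ : ℝ}
    (hl₀ : 0 < l₀) (h₀ : ∀ a, l₀ ≤ L a) (b : A) : Continuous (hullTent ϑ L b) := by
  refine (isQuotientMap_hullMk ϑ L).continuous_iff.2 ?_
  exact (continuous_tent hl₀ h₀ b).comp
    ((continuous_subtype_val.comp continuous_fst).prodMk continuous_snd)

/-- Points of the hull are close when all tents agree up to `ε` at the times `j / p`, `j < p`. -/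
def tentEntourage (ϑ : RandomSubstitution A) (L : A → ℝ) (p : ℕ) (ε : ℝ) :
    Set (HullSpace ϑ L × HullSpace ϑ L) :=
  {y | ∀ (b : A) (j : Fin p), |hullTent ϑ L b (ϑ.geometricHull L ((j : ℕ) / p) y.1) -
    hullTent ϑ L b (ϑ.geometricHull L ((j : ℕ) / p) y.2)| < ε}

theorem tentEntourage_mem_nhdsSet [Finite A] [DiscreteTopology A] (ϑ : RandomSubstitution A)
    {l₀ : ℝ} (hl₀ : 0 < l₀) (h₀ : ∀ a, l₀ ≤ L a) (p : ℕ) {ε : ℝ} (hε : 0 < ε) :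
    tentEntourage ϑ L p ε ∈ 𝓝ˢ (diagonal (HullSpace ϑ L)) := by
  have hopen : IsOpen (tentEntourage ϑ L p ε) := by
    simp only [tentEntourage, Set.ofPred_forall]
    refine isOpen_iInter_of_finite fun b => isOpen_iInter_of_finite fun j => ?_
    have h := (continuous_hullTent ϑ hl₀ h₀ b).comp
      ((ϑ.geometricHull L).continuous_toFun ((j : ℕ) / p : ℝ))
    exact isOpen_lt ((h.comp continuous_fst).sub (h.comp continuous_snd)).abs continuous_const
  refine hopen.mem_nhdsSet.2 ?_
  rintro ⟨y, y'⟩ h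
  obtain rfl : y = y' := h
  intro b j
  simpa using hε

/-- Tilings with a common vertex at the origin which first differ in a tile ending before time
`n` are separated by the tents before time `n`. -/
theorem exists_tent_separation {ϑ : RandomSubstitution A} {l₀ : ℝ} (hl₀ : 0 < l₀)
    (h₀ : ∀ a, l₀ ≤ L a) {p : ℕ} (hp : 4 / l₀ ≤ p) {x x' : ϑ.subshift} {j n : ℕ}
    (hagree : ∀ k : ℕ, k < j → x.1 k = x'.1 k) (hne : x.1 j ≠ x'.1 j)
    (hn : tilePos L x.1 (j + 1) ≤ n) :
    ∃ k < n, ∃ (i : Fin p) (b : A), l₀ / 4 ≤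
      |hullTent ϑ L b (ϑ.geometricHull L ((i : ℕ) / p)
          ((ϑ.geometricHull L 1)^[k] (hullMk ϑ L (x, 0)))) -
        hullTent ϑ L b (ϑ.geometricHull L ((i : ℕ) / p)
          ((ϑ.geometricHull L 1)^[k] (hullMk ϑ L (x', 0))))| := by
  have hL : ∀ a, 0 < L a := fun a => hl₀.trans_le (h₀ a)
  have hp0 : (0 : ℝ) < p := lt_of_lt_of_le (by positivity) hp
  have hpn : 0 < p := by exact_mod_cast hp0
  have hp1 : 1 ≤ p * (l₀ / 4) := by rw [div_le_iff₀ hl₀] at hp; linarith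
  set τ := tilePos L x.1 j with hτ
  have hτ' : tilePos L x'.1 j = τ := (tilePos_congr hagree).symm
  have hτ0 : 0 ≤ τ := by
    have := tilePos_mono hL x.1 (show (0 : ℤ) ≤ j by omega)
    rwa [tilePos_zero] at this
  have hx1 : tilePos L x.1 (j + 1) = τ + L (x.1 j) := tilePos_add_one _ _
  have hx1' : tilePos L x'.1 (j + 1) = τ + L (x'.1 j) := by rw [tilePos_add_one, hτ']
  -- The tiles of both points at `τ` have length at least `l₀`. Since `1 / p ≤ l₀ / 4`, some
  -- sampling time `r / p` falls in `[τ + l₀ / 4, τ + l₀ / 2)`, at distance at least `l₀ / 4` from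
  -- the ends of both tiles.
  set r := ⌈p * (τ + l₀ / 4)⌉₊ with hr
  have hr1 : τ + l₀ / 4 ≤ r / p := by
    rw [le_div_iff₀ hp0, mul_comm]; exact Nat.le_ceil _
  have hr2 : (r : ℝ) / p < τ + l₀ / 2 := by
    rw [div_lt_iff₀ hp0]
    have := Nat.ceil_lt_add_one (show 0 ≤ p * (τ + l₀ / 4) by positivity)
    rw [← hr] at this
    linarith
  have h0j := h₀ (x.1 j)
  have h0j' := h₀ (x'.1 j)
  -- Division with remainder splits the time into unit steps and a sampling offset. There the tent
  -- of type `x.1 j` is at least `l₀ / 4` for `x` and vanishes for `x'`.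
  refine ⟨r / p, ?_, ⟨r % p, Nat.mod_lt _ hpn⟩, x.1 j, ?_⟩
  · rw [Nat.div_lt_iff_lt_mul hpn]
    have : (r : ℝ) / p < n := by linarith
    rw [div_lt_iff₀ hp0] at this
    exact_mod_cast this
  · have htime : (0 : ℝ) + (r / p : ℕ) + (r % p : ℕ) / p = r / p := by
      have := congrArg (Nat.cast (R := ℝ)) (Nat.div_add_mod r p)
      push_cast at this
      field_simp
      linarith
    simp only [geometricHull_iterate_hullMk, geometricHull_hullMk, hullTent_hullMk, htime]
    rw [tent_eq hL (x.1 j) (j := j) (by linarith) (by linarith),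
      tent_eq hL (x.1 j) (x := x'.1) (j := j) (by linarith) (by linarith)]
    simp only [tentTerm, if_true, if_neg (Ne.symm hne), zero_mul, sub_zero, one_mul]
    refine le_trans ?_ (le_abs_self _)
    refine le_max_of_le_right (le_min ?_ ?_) <;> linarith

/-- The separation of inflation words bounds the dynamical covering numbers from below. -/
theorem exists_card_le_coverMincard [Fintype A] [Nonempty A] [DiscreteTopology A]
    {ϑ : RandomSubstitution A} (hprim : ϑ.IsPrimitive) {lam : ℝ}
    (hgeom : ϑ.IsGeomCompatible lam L) :
    ∃ U ∈ 𝓝ˢ (diagonal (HullSpace ϑ L)), ∀ (m : ℕ) (a : A) (n : ℕ), lam ^ m * L a ≤ n →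
      (((ϑ.pow m).toFun a).card : ℕ∞) ≤
        Dynamics.coverMincard (ϑ.geometricHull L 1) univ U n := by
  classical
  obtain ⟨l₀, -, hl₀, h₀, -⟩ := exists_length_bounds hgeom.pos
  set p := ⌈4 / l₀⌉₊
  -- Half of the separation `l₀ / 4`, so that separated points cannot share a centre.
  refine ⟨tentEntourage ϑ L p (l₀ / 8),
    tentEntourage_mem_nhdsSet ϑ hl₀ h₀ p (by positivity), fun m a n hn => ?_⟩
  refine le_iInf₂ fun s hs => ?_
  have hx : ∀ w : List A, ∃ x : ϑ.subshift, w ∈ (ϑ.pow m).toFun a → window x.1 0 w.length = w := by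
    intro w
    by_cases hw : w ∈ (ϑ.pow m).toFun a
    · obtain ⟨x, hx⟩ := exists_window_eq hprim hgeom hw
      exact ⟨x, fun _ => hx⟩
    · obtain ⟨w', hw'⟩ := (ϑ.pow m).nonempty' a
      obtain ⟨x, -⟩ := exists_window_eq hprim hgeom hw'
      exact ⟨x, fun h => absurd h hw⟩
  choose x hx using hx
  have hc : ∀ w, ∃ c ∈ s, (hullMk ϑ L (x w, 0), c) ∈
      Dynamics.dynEntourage (ϑ.geometricHull L 1) (tentEntourage ϑ L p (l₀ / 8)) n :=
    fun w => hs (mem_univ _)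
  choose c hcs hc using hc
  -- For any cover `s`, assigning to a word the centre of a ball containing its point is injective.
  refine Nat.cast_le.2 (Finset.card_le_card_of_injOn c (fun w _ => hcs w) ?_)
  intro w hw w' hw' hcc
  by_contra hne
  have hinf := hgeom.inflates.pow m a
  rw [Finset.mem_coe] at hw hw'
  obtain ⟨j, h1, h2, h3⟩ := exists_first_disagreement hgeom.pos (x := (x w).1) (x' := (x w').1)
    (n := w.length) (n' := w'.length) (by rwa [hx w hw, hx w' hw'])
    (by rw [hx w hw, hx w' hw', hinf w hw, hinf w' hw'])
  rw [hx w hw, hinf w hw] at h3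
  obtain ⟨k, hk, i, b, hsep⟩ := exists_tent_separation hl₀ h₀ (Nat.le_ceil _) h1 h2 (h3.trans hn)
  have e1 := Dynamics.mem_dynEntourage.1 (hc w) k hk b i
  have e2 := Dynamics.mem_dynEntourage.1 (hc w') k hk b i
  rw [← hcc] at e2
  rw [abs_lt] at e1 e2
  have : ∀ u v z : ℝ, (-(l₀ / 8) < u - z ∧ u - z < l₀ / 8) →
      (-(l₀ / 8) < v - z ∧ v - z < l₀ / 8) → |u - v| < l₀ / 4 := by
    intro u v z hu hv
    rw [abs_lt]
    constructor <;> linarith [hu.1, hu.2, hv.1, hv.2]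
  exact absurd hsep (not_le.2 (this _ _ _ e1 e2))

end Hull

end RandomSubstitution

/-- A covering of a space by the fibres of a map with finite range, each of which has small
dynamical diameter, bounds the dynamical covering numbers from above. -/
theorem coverMincard_le_card_of_fibres {Z Y ι : Type*} {T : Y → Y} {U : Set (Y × Y)} {n : ℕ}
    {ψ : Z → Y} (hψ : Function.Surjective ψ) {φ : Z → ι} {F : Finset ι} (hφ : ∀ z, φ z ∈ F)
    (h : ∀ z z', φ z = φ z' → (ψ z, ψ z') ∈ Dynamics.dynEntourage T U n) :
    Dynamics.coverMincard T univ U n ≤ F.card := by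
  classical
  rcases isEmpty_or_nonempty Z with hZ | hZ
  · have : (univ : Set Y) = ∅ := by
      rw [univ_eq_empty_iff]
      exact ⟨fun y => hZ.elim (hψ y).choose⟩
    rw [this, Dynamics.coverMincard_empty]
    exact zero_le
  · have hg : ∀ i, ∃ z : Z, (∃ z', φ z' = i) → φ z = i := by
      intro i
      by_cases hi : ∃ z', φ z' = i
      · obtain ⟨z, hz⟩ := hi
        exact ⟨z, fun _ => hz⟩
      · exact ⟨Classical.arbitrary Z, fun h => absurd h hi⟩
    choose g hg using hg
    have hcover : Dynamics.IsDynCoverOf T univ U n (F.image fun i => ψ (g i) : Finset Y) := by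
      intro y _
      obtain ⟨z, rfl⟩ := hψ y
      refine ⟨ψ (g (φ z)), ?_, h _ _ (hg _ ⟨z, rfl⟩).symm⟩
      rw [Finset.mem_coe]
      exact Finset.mem_image_of_mem _ (hφ z)
    exact hcover.coverMincard_le_card.trans (Nat.cast_le.2 Finset.card_image_le)

theorem Real.abs_sub_lt_of_floor_div_eq {s s' ε : ℝ} (hε : 0 < ε) (hs : 0 ≤ s) (hs' : 0 ≤ s')
    (h : ⌊s / ε⌋₊ = ⌊s' / ε⌋₊) : |s - s'| < ε := by
  have h1 := Nat.floor_le (div_nonneg hs hε.le)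
  have h2 := Nat.lt_floor_add_one (s / ε)
  have h1' := Nat.floor_le (div_nonneg hs' hε.le)
  have h2' := Nat.lt_floor_add_one (s' / ε)
  rw [h] at h1 h2
  rw [le_div_iff₀ hε] at h1 h1'
  rw [div_lt_iff₀ hε] at h2 h2'
  rw [abs_lt]
  constructor <;> linarith

namespace RandomSubstitution

/-! ### Locating a time in a tiling -/

section Locate

variable {A : Type*} {L : A → ℝ}

theorem tilePos_sub_le {l₁ : ℝ} (h₁ : ∀ a, L a ≤ l₁) (x : ℤ → A) {j k : ℤ} (h : j ≤ k) :
    tilePos L x k - tilePos L x j ≤ l₁ * (k - j) := by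
  induction k, h using Int.leInduction with
  | base => simp
  | succ k _ ih => rw [tilePos_add_one]; push_cast; linarith [h₁ (x k)]

theorem geomLength_window [Fintype A] [DecidableEq A] (x : ℤ → A) (i : ℤ) (n : ℕ) :
    geomLength L (window x i n) = tilePos L x (i + n) - tilePos L x i := by
  induction n with
  | zero => simp [window]
  | succ n ih =>
    rw [window_succ, geomLength_append, ih]
    push_cast
    rw [← add_assoc, tilePos_add_one, geomLength_singleton]
    ring

theorem exists_tilePos_le_lt {l₀ : ℝ} (hl₀ : 0 < l₀) (h₀ : ∀ a, l₀ ≤ L a) (x : ℤ → A) {t : ℝ}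
    (ht : 0 ≤ t) : ∃ j : ℕ, tilePos L x j ≤ t ∧ t < tilePos L x (j + 1) := by
  classical
  have hex : ∃ M : ℕ, t < tilePos L x M := by
    obtain ⟨M, hM⟩ := exists_nat_gt (t / l₀)
    refine ⟨M, ?_⟩
    have := mul_sub_le_tilePos_sub h₀ x (show (0 : ℤ) ≤ M by omega)
    rw [tilePos_zero] at this
    rw [div_lt_iff₀ hl₀] at hM
    push_cast at this
    linarith
  have hspec := Nat.find_spec hex
  have hmin := fun m => Nat.find_min hex (m := m)
  cases hM : Nat.find hex with
  | zero => rw [hM] at hspec; simp at hspec; linarith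
  | succ j =>
    refine ⟨j, not_lt.1 (hmin j (by omega)), ?_⟩
    rw [hM] at hspec
    exact_mod_cast hspec

end Locate

/-! ### Uniform cylinders from compactness -/

section Cylinder

variable {A : Type*} [TopologicalSpace A]

/-- A neighbourhood of a point of the subshift contains a cylinder. -/
theorem exists_cylinder_subset {X : Set (ℤ → A)} {x : X} {s : Set X} (hs : s ∈ 𝓝 x) :
    ∃ N : ℕ, ∀ x' : X, (∀ k : ℤ, |k| ≤ N → x.1 k = x'.1 k) → x' ∈ s := by
  rw [nhds_subtype_eq_comap, mem_comap] at hs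
  obtain ⟨t, ht, hts⟩ := hs
  rw [nhds_pi, Filter.mem_pi] at ht
  obtain ⟨I, hI, u, hu, hut⟩ := ht
  obtain ⟨N, hN⟩ := (hI.image Int.natAbs).bddAbove
  refine ⟨N, fun x' hx' => hts (hut fun k hk => ?_)⟩
  have : |k| ≤ N := by
    rw [Int.abs_eq_natAbs]
    exact_mod_cast hN (mem_image_of_mem _ hk)
  rw [← hx' k this]
  exact mem_of_mem_nhds (hu k)

/-- A neighbourhood of the diagonal of `X × ℝ` contains all pairs of points over a compact
interval which have a long common central word and nearby heights. -/
theorem exists_uniform_cylinder [DiscreteTopology A] {X : Set (ℤ → A)} [CompactSpace X] {V : Set ((X × ℝ) × (X × ℝ))}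
    (hV : ∀ p, V ∈ 𝓝 (p, p)) (R : ℝ) :
    ∃ (N : ℕ) (ε : ℝ), 0 < ε ∧ ∀ (x x' : X) (s s' : ℝ), 0 ≤ s → s ≤ R →
      (∀ k : ℤ, |k| ≤ N → x.1 k = x'.1 k) → |s - s'| < ε → ((x, s), (x', s')) ∈ V := by
  have hK : IsCompact ((univ : Set X) ×ˢ Icc (0 : ℝ) R) := isCompact_univ.prod isCompact_Icc
  have key : ∃ (N : ℕ) (ε : ℝ), 0 < ε ∧ ∀ p ∈ (univ : Set X) ×ˢ Icc (0 : ℝ) R,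
      ∀ (x' : X) (s' : ℝ), (∀ k : ℤ, |k| ≤ N → p.1.1 k = x'.1 k) → |p.2 - s'| < ε →
        (p, (x', s')) ∈ V := by
    refine hK.induction_on (p := fun S => ∃ (N : ℕ) (ε : ℝ), 0 < ε ∧ ∀ p ∈ S,
      ∀ (x' : X) (s' : ℝ), (∀ k : ℤ, |k| ≤ N → p.1.1 k = x'.1 k) → |p.2 - s'| < ε →
        (p, (x', s')) ∈ V) ⟨0, 1, one_pos, by simp⟩ ?_ ?_ ?_
    · rintro S S' hS ⟨N, ε, hε, h⟩
      exact ⟨N, ε, hε, fun p hp => h p (hS hp)⟩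
    · rintro S S' ⟨N, ε, hε, h⟩ ⟨N', ε', hε', h'⟩
      refine ⟨max N N', min ε ε', lt_min hε hε', ?_⟩
      rintro p (hp | hp) x' s' hk hs
      · exact h p hp x' s' (fun k hkN => hk k (hkN.trans (by exact_mod_cast le_max_left _ _)))
          (hs.trans_le (min_le_left _ _))
      · exact h' p hp x' s' (fun k hkN => hk k (hkN.trans (by exact_mod_cast le_max_right _ _)))
          (hs.trans_le (min_le_right _ _))
    · rintro ⟨x, s⟩ -
      have h := hV (x, s)
      rw [nhds_prod_eq, Filter.mem_prod_same_iff] at h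
      obtain ⟨W, hW, hWV⟩ := h
      obtain ⟨B, hB, C, hC, hBC⟩ := mem_nhds_prod_iff.1 hW
      obtain ⟨N, hN⟩ := exists_cylinder_subset hB
      obtain ⟨ε, hε, hεC⟩ := Metric.mem_nhds_iff.1 hC
      -- Radius `ε / 2` is used twice: `s₁` is that close to `s`, and `s'` that close to `s₁`, so
      -- both heights lie in the `ε`-ball about `s`.
      refine ⟨{x' : X | ∀ k ∈ Finset.Icc (-(N : ℤ)) N, x'.1 k = x.1 k} ×ˢ Metric.ball s (ε / 2),
        mem_nhdsWithin_of_mem_nhds (prod_mem_nhds ?_ (Metric.ball_mem_nhds _ (by positivity))),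
        N, ε / 2, by positivity, ?_⟩
      · have : {x' : X | ∀ k ∈ Finset.Icc (-(N : ℤ)) N, x'.1 k = x.1 k} =
            ⋂ k ∈ Finset.Icc (-(N : ℤ)) N, {x' : X | x'.1 k = x.1 k} := by ext; simp
        rw [this, Filter.biInter_finset_mem]
        intro k _
        have hc : Continuous fun x' : X => x'.1 k :=
          (continuous_apply k).comp continuous_subtype_val
        exact hc.continuousAt.preimage_mem_nhds ((isOpen_discrete {x.1 k}).mem_nhds rfl)
      · rintro ⟨x₁, s₁⟩ ⟨hx₁, hs₁⟩ x' s' hk hs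
        simp only [Metric.mem_ball, Real.dist_eq] at hs₁
        simp only at hk hs hx₁
        have hx₁' : ∀ k : ℤ, |k| ≤ N → x.1 k = x₁.1 k := fun k hkN =>
          (hx₁ k (Finset.mem_Icc.2 (abs_le.1 hkN))).symm
        refine hWV ⟨hBC ⟨hN _ hx₁', hεC ?_⟩,
          hBC ⟨hN _ fun k hkN => (hx₁' k hkN).trans (hk k hkN), hεC ?_⟩⟩
        · rw [Metric.mem_ball, Real.dist_eq]; linarith
        · rw [Metric.mem_ball, Real.dist_eq]
          rw [abs_lt] at hs₁ hs ⊢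
          constructor <;> linarith
  obtain ⟨N, ε, hε, h⟩ := key
  exact ⟨N, ε, hε, fun x x' s s' h0 h1 => h (x, s) ⟨mem_univ _, h0, h1⟩ x' s'⟩

end Cylinder

/-! ### Covering the hull by legal words -/

section HullCover

variable {A : Type*} [DecidableEq A] {L : A → ℝ}

theorem hullMk_add_tilePos {ϑ : RandomSubstitution A} (x : ϑ.subshift) (s : ℝ) (j : ℕ) :
    hullMk ϑ L (x, s + tilePos L x.1 j) = hullMk ϑ L (ϑ.shift^[j] x, s) := by
  induction j generalizing s with
  | zero => simp
  | succ j ih =>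
    have h0 : (ϑ.shift^[j] x).1 0 = x.1 j := by rw [shift_iterate_apply, zero_add]
    rw [Function.iterate_succ_apply', ← hullMk_shift, h0, ← ih]
    push_cast
    rw [tilePos_add_one, add_assoc, add_comm (L _)]

/-- Passing to a preimage under the surjective shift raises the height by at least `l₀`, so it can
be made non-negative; removing whole tiles then brings it below `l₁`. -/
theorem exists_hullMk_eq {ϑ : RandomSubstitution A} {l₀ l₁ : ℝ} (hl₀ : 0 < l₀)
    (h₀ : ∀ a, l₀ ≤ L a) (h₁ : ∀ a, L a ≤ l₁) (y : HullSpace ϑ L) :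
    ∃ x s, 0 ≤ s ∧ s ≤ l₁ ∧ hullMk ϑ L (x, s) = y := by
  have key : ∀ (n : ℕ) (x : ϑ.subshift) (s : ℝ), -(n * l₀) ≤ s →
      ∃ x' s', 0 ≤ s' ∧ hullMk ϑ L (x', s') = hullMk ϑ L (x, s) := by
    intro n
    induction n with
    | zero => exact fun x s hs => ⟨x, s, by simpa using hs, rfl⟩
    | succ n ih =>
      intro x s hs
      obtain ⟨x', rfl⟩ := shift_surjective ϑ x
      push_cast at hs
      obtain ⟨x'', s'', h, he⟩ := ih x' (s + L (x'.1 0)) (by linarith [h₀ (x'.1 0)])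
      exact ⟨x'', s'', h, he.trans (hullMk_shift x' s)⟩
  induction y using Quot.ind with
  | mk p =>
    obtain ⟨x, s⟩ := p
    obtain ⟨n, hn⟩ := exists_nat_ge (-s / l₀)
    rw [div_le_iff₀ hl₀] at hn
    obtain ⟨x', s', hs', he⟩ := key n x s (by linarith)
    obtain ⟨j, hj1, hj2⟩ := exists_tilePos_le_lt hl₀ h₀ x'.1 hs'
    rw [tilePos_add_one] at hj2
    refine ⟨ϑ.shift^[j] x', s' - tilePos L x'.1 j, by linarith, by linarith [h₁ (x'.1 j)], ?_⟩
    rw [← hullMk_add_tilePos, sub_add_cancel, he]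
    rfl

variable [TopologicalSpace A] [DiscreteTopology A]

/-- The dynamical covering numbers of the geometric hull are bounded by the number of legal
words of bounded geometric length. -/
theorem exists_coverMincard_le [Fintype A] [Nonempty A] (ϑ : RandomSubstitution A)
    (hL : ∀ a, 0 < L a) {U : Set (HullSpace ϑ L × HullSpace ϑ L)}
    (hU : U ∈ 𝓝ˢ (diagonal (HullSpace ϑ L))) :
    ∃ (c : ℝ) (G : ℕ), 0 ≤ c ∧ ∀ n : ℕ, ∃ W : Finset (List A),
      (∀ w ∈ W, w ∈ ϑ.language ∧ geomLength L w ≤ n + c) ∧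
      Dynamics.coverMincard (ϑ.geometricHull L 1) univ U n ≤ (W.card * G : ℕ) := by
  classical
  obtain ⟨l₀, l₁, hl₀, h₀, h₁⟩ := exists_length_bounds hL
  have hl₁ : 0 < l₁ := hl₀.trans_le ((h₀ (Classical.arbitrary A)).trans (h₁ _))
  have := compactSpace_subshift ϑ
  have hcont : Continuous (Prod.map (hullMk ϑ L) (hullMk ϑ L)) :=
    (isQuotientMap_hullMk ϑ L).continuous.prodMap (isQuotientMap_hullMk ϑ L).continuous
  have hV : ∀ p, Prod.map (hullMk ϑ L) (hullMk ϑ L) ⁻¹' U ∈ 𝓝 (p, p) := fun p =>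
    hcont.continuousAt.preimage_mem_nhds (mem_nhdsSet_iff_forall.1 hU _ rfl)
  obtain ⟨N, ε, hε, hunif⟩ := exists_uniform_cylinder hV l₁
  -- The term `2 * l₁` bounds the overshoot of the tile boundary `M` beyond time `n`; the rest pays
  -- for `N` further letters on the left and `N + 1` on the right. The second entry counts the
  -- height classes of width `ε` in `[0, l₁]`.
  refine ⟨2 * l₁ + (2 * N + 1) * l₁, ⌊l₁ / ε⌋₊ + 1, by positivity, fun n => ?_⟩
  set c := 2 * l₁ + (2 * N + 1) * l₁ with hc
  have hc0 : 0 ≤ c := by positivity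
  set W := (wordsUpTo A ⌊(n + c) / l₀⌋₊).filter
    fun w => w ∈ ϑ.language ∧ geomLength L w ≤ n + c with hW
  refine ⟨W, fun w hw => (Finset.mem_filter.1 hw).2, ?_⟩
  -- A boundary beyond `n + l₁`: starting at height at most `l₁`, the orbit up to time `n` visits
  -- only tiles of index below `M`.
  have hlocate : ∀ x : ϑ.subshift, ∃ M : ℕ, n + l₁ < tilePos L x.1 M ∧
      tilePos L x.1 M ≤ n + 2 * l₁ := by
    intro x
    obtain ⟨j, h1, h2⟩ := exists_tilePos_le_lt hl₀ h₀ x.1 (show (0 : ℝ) ≤ n + l₁ by positivity)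
    refine ⟨j + 1, by exact_mod_cast h2, ?_⟩
    push_cast
    rw [tilePos_add_one]
    linarith [h₁ (x.1 j)]
  choose M hM1 hM2 using hlocate
  let Z := {p : ϑ.subshift × ℝ // 0 ≤ p.2 ∧ p.2 ≤ l₁}
  let φ : Z → List A × ℕ := fun z =>
    (window z.1.1.1 (-N) (M z.1.1 + 2 * N + 1), ⌊z.1.2 / ε⌋₊)
  have hcard : W.card * (⌊l₁ / ε⌋₊ + 1) = (W ×ˢ Finset.range (⌊l₁ / ε⌋₊ + 1)).card := by
    rw [Finset.card_product, Finset.card_range]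
  rw [hcard]
  refine coverMincard_le_card_of_fibres (ψ := fun z : Z => hullMk ϑ L z.1) (φ := φ) ?_ ?_ ?_
  · intro y
    obtain ⟨x, s, h0, h1, rfl⟩ := exists_hullMk_eq hl₀ h₀ h₁ y
    exact ⟨⟨(x, s), h0, h1⟩, rfl⟩
  · rintro ⟨⟨x, s⟩, hs0, hs1⟩
    simp only at hs0 hs1
    have hlen : geomLength L (window x.1 (-N) (M x + 2 * N + 1)) ≤ n + c := by
      rw [geomLength_window]
      have e1 := tilePos_sub_le h₁ x.1 (show (-N : ℤ) ≤ 0 by omega)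
      have e2 := tilePos_sub_le h₁ x.1 (show (M x : ℤ) ≤ -N + (M x + 2 * N + 1 : ℕ) by
        push_cast; omega)
      rw [tilePos_zero] at e1
      push_cast at e1 e2 ⊢
      linarith [hM2 x]
    refine Finset.mem_product.2 ⟨Finset.mem_filter.2 ⟨mem_wordsUpTo ?_, ?_, hlen⟩, ?_⟩
    · refine Nat.le_floor ?_
      rw [le_div_iff₀ hl₀]
      linarith [mul_length_le_geomLength h₀ (window x.1 (-N) (M x + 2 * N + 1))]
    · exact x.2 _ _ (by omega)
    · rw [Finset.mem_range, Nat.lt_succ_iff]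
      exact Nat.floor_mono (by gcongr)
  · rintro ⟨⟨x, s⟩, hs0, hs1⟩ ⟨⟨x', s'⟩, hs0', hs1'⟩ h
    simp only [φ, Prod.mk.injEq] at h hs0 hs1 hs0' hs1'
    obtain ⟨hw, hf⟩ := h
    have hss := Real.abs_sub_lt_of_floor_div_eq hε hs0 hs0' hf
    have hMM : M x = M x' := by
      have := congrArg List.length hw
      simp at this
      exact this
    rw [← hMM, window_eq_iff] at hw
    have hag : ∀ k : ℤ, -N ≤ k → k ≤ M x + N → x.1 k = x'.1 k := by
      intro k h1 h2
      have := hw (k + N).toNat (by omega)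
      rwa [show -(N : ℤ) + (k + N).toNat = k by omega] at this
    refine Dynamics.mem_dynEntourage.2 fun k hk => ?_
    simp only [geometricHull_iterate_hullMk]
    obtain ⟨j, hj1, hj2⟩ := exists_tilePos_le_lt hl₀ h₀ x.1 (show 0 ≤ s + k by positivity)
    have hk' : (k : ℝ) < n := by exact_mod_cast hk
    have hjM : j < M x := by
      by_contra! hle
      have := tilePos_mono hL x.1 (show (M x : ℤ) ≤ j by omega)
      linarith [hM1 x]
    have hpos : tilePos L x'.1 j = tilePos L x.1 j :=
      (tilePos_congr fun i hi => hag i (by omega) (by omega)).symm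
    rw [tilePos_add_one] at hj2
    rw [← sub_add_cancel (s + k) (tilePos L x.1 j), hullMk_add_tilePos,
      ← sub_add_cancel (s' + k) (tilePos L x'.1 j), hullMk_add_tilePos, hpos]
    -- Both points have been rebased at the same tile `j`, since the words agree up to there. Only
    -- the first height must lie in `[0, l₁]`; the second may leave its tile.
    refine hunif _ _ _ _ (by linarith) (by linarith [h₁ (x.1 j)]) (fun i hi => ?_) ?_
    · rw [abs_le] at hi
      rw [shift_iterate_apply, shift_iterate_apply]
      exact hag _ (by omega) (by omega)
    · convert hss using 2
      ring

end HullCover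

end RandomSubstitution

/-! ### Subexponential factors and the averaging argument -/

theorem Real.eventually_polynomial_mul_le_exp (P : Polynomial ℝ) {δ : ℝ} (hδ : 0 < δ) :
    ∀ᶠ n : ℕ in atTop, P.eval (n : ℝ) ≤ Real.exp (δ * n) := by
  have ht : Tendsto (fun n : ℕ => δ * (n : ℝ)) atTop atTop :=
    tendsto_natCast_atTop_atTop.const_mul_atTop hδ
  have h := ((P.comp (Polynomial.C δ⁻¹ * Polynomial.X)).tendsto_div_exp_atTop.comp ht).eventually
    (gt_mem_nhds zero_lt_one)
  filter_upwards [h] with n hn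
  simp only [Function.comp_apply, Polynomial.eval_comp, Polynomial.eval_mul, Polynomial.eval_C,
    Polynomial.eval_X, inv_mul_cancel_left₀ hδ.ne'] at hn
  rw [div_lt_one (Real.exp_pos _)] at hn
  exact hn.le

theorem EReal.exp_coe_mul_natCast (a : ℝ) (n : ℕ) :
    EReal.exp ((a : EReal) * n) = ENNReal.ofReal (Real.exp (a * n)) := by
  rw [← EReal.exp_coe]
  push_cast
  rfl

/-- If a sequence of positive functions on a finite set averages out in `N` steps, then the
asymptotic behaviour of the maximum is shared by all values. -/
theorem tendsto_of_averaging {A : Type*} {u : ℕ → A → ℝ} {h δ : ℝ} {N : ℕ}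
    (hu : ∀ m a, 0 ≤ u m a) (hδ : 0 < δ) (hδ1 : δ ≤ 1)
    (hupper : ∀ c, h < c → ∀ a, ∀ᶠ m in atTop, u m a ≤ c)
    (hlower : ∀ c, c < h → ∀ᶠ m in atTop, ∃ b, c ≤ u m b)
    (havg : ∀ m t, (∀ c, t ≤ u m c) → ∀ a b, t + δ * (u m b - t) ≤ u (N + m) a) (a : A) :
    Tendsto (fun m => u m a) atTop (𝓝 h) := by
  -- The eventual lower bounds common to all letters; it suffices that their supremum is at least
  -- `h`.
  set S := {t : ℝ | ∀ᶠ m in atTop, ∀ c, t ≤ u m c} with hS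
  have h0 : (0 : ℝ) ∈ S := Eventually.of_forall fun m c => hu m c
  have hbdd : BddAbove S := by
    refine ⟨h + 1, fun t ht => ?_⟩
    obtain ⟨m, hm1, hm2⟩ := (ht.and (hupper (h + 1) (by linarith) a)).exists
    exact (hm1 a).trans hm2
  have hsup : h ≤ sSup S := by
    by_contra! hlt
    set d := h - sSup S
    have hd : 0 < d := by simp only [d]; linarith
    -- If the supremum fell short by `d`, one averaging step with a value near `h` would give the
    -- lower bound `sSup S - ε + δ * d = sSup S + 3 * ε`, which exceeds the supremum.
    set ε := δ * d / 4 with hε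
    have hε0 : 0 < ε := by positivity
    obtain ⟨t, htS, ht⟩ := exists_lt_of_lt_csSup ⟨0, h0⟩ (show sSup S - ε < sSup S by linarith)
    have hmem : sSup S + ε ∈ S := by
      have hev := htS.and (hlower (h - ε) (by linarith))
      have hshift : ∀ᶠ m in atTop, ∀ c, sSup S + ε ≤ u (N + m) c := by
        filter_upwards [hev] with m hm c
        obtain ⟨hm1, b, hb⟩ := hm
        have := havg m t hm1 c b
        have e1 : (1 - δ) * (sSup S - ε) ≤ (1 - δ) * t := by gcongr
        have e2 : δ * (h - ε) ≤ δ * u m b := by gcongr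
        simp only [d] at hε
        linarith
      rw [← Filter.eventually_map (m := fun m => N + m)
        (P := fun m => ∀ c, sSup S + ε ≤ u m c)] at hshift
      have hmap : map (fun m => N + m) atTop = (atTop : Filter ℕ) := by
        simp only [add_comm N]
        exact map_add_atTop_eq_nat N
      rwa [hmap] at hshift
    linarith [le_csSup hbdd hmem]
  refine tendsto_order.2 ⟨fun c hc => ?_, fun c hc => ?_⟩
  · obtain ⟨t, htS, ht⟩ := exists_lt_of_lt_csSup ⟨0, h0⟩ (hc.trans_le hsup)
    filter_upwards [htS] with m hm
    exact ht.trans_le (hm a)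
  · filter_upwards [hupper ((h + c) / 2) (by linarith) a] with m hm
    linarith

namespace RandomSubstitution

/-! ### Inflation rates and topological entropy -/

section Entropy

theorem one_le_card_pow {A : Type*} [DecidableEq A] (ϑ : RandomSubstitution A) (m : ℕ) (a : A) :
    (1 : ℝ) ≤ ((ϑ.pow m).toFun a).card := by
  exact_mod_cast Finset.card_pos.2 ((ϑ.pow m).nonempty' a)

theorem coverEntropyEntourage_le_topologicalEntropy {A : Type*} [DecidableEq A] {L : A → ℝ}
    [TopologicalSpace A] (ϑ : RandomSubstitution A)
    {U : Set (HullSpace ϑ L × HullSpace ϑ L)} (hU : U ∈ 𝓝ˢ (diagonal (HullSpace ϑ L))) :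
    Dynamics.coverEntropyEntourage (ϑ.geometricHull L 1) univ U ≤
      (ϑ.geometricHull L).topologicalEntropy :=
  le_iSup₂ (f := fun U (_ : U ∈ 𝓝ˢ (diagonal (HullSpace ϑ L))) =>
    Dynamics.coverEntropyEntourage (ϑ.geometricHull L 1) univ U) U hU

variable {A : Type*} [Fintype A] [DecidableEq A] {L : A → ℝ}

/-- The ratio `log #ϑᵐ(a) / L(ϑᵐ(a))`. -/
noncomputable def inflationRate (ϑ : RandomSubstitution A) (lam : ℝ) (L : A → ℝ) (m : ℕ) (a : A) :
    ℝ :=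
  Real.log ((ϑ.pow m).toFun a).card / (lam ^ m * L a)

theorem IsGeomCompatible.pow_mul_pos {ϑ : RandomSubstitution A} {lam : ℝ}
    (hgeom : ϑ.IsGeomCompatible lam L) (m : ℕ) (a : A) : 0 < lam ^ m * L a :=
  mul_pos (pow_pos (zero_lt_one.trans hgeom.one_lt) m) (hgeom.pos a)

theorem IsGeomCompatible.inflationRate_nonneg {ϑ : RandomSubstitution A} {lam : ℝ}
    (hgeom : ϑ.IsGeomCompatible lam L) (m : ℕ) (a : A) : 0 ≤ inflationRate ϑ lam L m a :=
  div_nonneg (Real.log_nonneg (one_le_card_pow ϑ m a)) (hgeom.pow_mul_pos m a).le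

theorem IsGeomCompatible.log_card_eq {ϑ : RandomSubstitution A} {lam : ℝ}
    (hgeom : ϑ.IsGeomCompatible lam L) (m : ℕ) (a : A) :
    Real.log ((ϑ.pow m).toFun a).card = inflationRate ϑ lam L m a * (lam ^ m * L a) :=
  (div_mul_cancel₀ _ (hgeom.pow_mul_pos m a).ne').symm

/-- Fix a level-`N` marginal `θ` with every letter in every image. The words of `ϑᵐ(θ(a))` lie in
`ϑ^(N+m)(a)`, and by additivity their logarithmic count is a length-weighted sum of level-`m` rates.
One occurrence of `b` in `θ(a)` has weight `L_b / (λᴺ L_a)`, at least `l₀ / (λᴺ l₁)`; all other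
letters have rate at least `t`. -/
theorem exists_inflationRate_averaging [Nonempty A] {ϑ : RandomSubstitution A}
    (hprim : ϑ.IsPrimitive) {lam : ℝ} (hgeom : ϑ.IsGeomCompatible lam L) :
    ∃ (N : ℕ) (δ : ℝ), 0 < δ ∧ δ ≤ 1 ∧ ∀ m t, (∀ c, t ≤ inflationRate ϑ lam L m c) → ∀ a b,
      t + δ * (inflationRate ϑ lam L m b - t) ≤ inflationRate ϑ lam L (N + m) a := by
  obtain ⟨N, θ, hθ, hmem⟩ := hprim.exists_marginal
  obtain ⟨l₀, l₁, hl₀, h₀, h₁⟩ := exists_length_bounds hgeom.pos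
  have hl : l₀ ≤ l₁ := (h₀ (Classical.arbitrary A)).trans (h₁ _)
  have hl₁ : 0 < l₁ := hl₀.trans_le hl
  have hlam : 0 < lam := zero_lt_one.trans hgeom.one_lt
  have hN : 1 ≤ lam ^ N := one_le_pow₀ hgeom.one_lt.le
  refine ⟨N, l₀ / (lam ^ N * l₁), by positivity, ?_, fun m t ht a b => ?_⟩
  · rw [div_le_one (by positivity)]
    nlinarith
  have hμ : 0 < lam ^ m := pow_pos hlam m
  set r := inflationRate ϑ lam L m b with hr
  have hLa := hgeom.pos a
  have hsum : ∀ w : List A, t * (lam ^ m * geomLength L w) ≤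
      (w.map fun c => Real.log ((ϑ.pow m).toFun c).card).sum := by
    intro w
    calc t * (lam ^ m * geomLength L w) = (w.map fun c => t * lam ^ m * L c).sum := by
          rw [List.sum_map_mul_left, geomLength_eq_sum_map]; ring
      _ ≤ _ := List.sum_le_sum fun c _ => by
          rw [hgeom.log_card_eq, mul_assoc]
          exact mul_le_mul_of_nonneg_right (ht c) (hgeom.pow_mul_pos m c).le
  have hlog : (((θ a).map fun c => Real.log ((ϑ.pow m).toFun c).card).sum) ≤
      Real.log ((ϑ.pow (N + m)).toFun a).card := by
    rw [← (hgeom.inflates.pow m).log_card_onWord hgeom.pos]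
    refine Real.log_le_log ?_ (Nat.cast_le.2 (Finset.card_le_card fun z hz =>
      mem_pow_add.2 ⟨θ a, hθ a, hz⟩))
    exact_mod_cast Finset.card_pos.2 ((ϑ.pow m).onWord_nonempty _)
  have hlen := hgeom.inflates.pow N a _ (hθ a)
  obtain ⟨p, p', hp⟩ := List.append_of_mem (hmem b a)
  rw [hp, List.map_append, List.sum_append, List.map_cons, List.sum_cons, hgeom.log_card_eq,
    ← hr] at hlog
  rw [hp, geomLength_append, geomLength_cons] at hlen
  have e1 := hsum p
  have e2 := hsum p'
  have hfrac : l₀ / (lam ^ N * l₁) ≤ L b / (lam ^ N * L a) := by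
    have := h₀ b
    have := h₁ a
    have := (hgeom.pos b).le
    gcongr
  have hrt : 0 ≤ r - t := sub_nonneg.2 (ht b)
  calc t + l₀ / (lam ^ N * l₁) * (r - t) ≤ t + L b / (lam ^ N * L a) * (r - t) := by gcongr
    _ = (t * (lam ^ m * (lam ^ N * L a)) + (r - t) * (lam ^ m * L b)) /
          (lam ^ (N + m) * L a) := by
        rw [pow_add]; field_simp
    _ ≤ inflationRate ϑ lam L (N + m) a := by
        unfold inflationRate
        refine div_le_div_of_nonneg_right ?_ (hgeom.pow_mul_pos _ a).le
        rw [← hlen]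
        linarith

variable [TopologicalSpace A] [DiscreteTopology A]

/-- Inflation words grow at most at the rate of the topological entropy. -/
theorem eventually_log_card_le {ϑ : RandomSubstitution A} (hprim : ϑ.IsPrimitive) {lam : ℝ}
    (hgeom : ϑ.IsGeomCompatible lam L) {c : ℝ}
    (hc : (ϑ.geometricHull L).topologicalEntropy < c) (a : A) :
    0 ≤ c ∧ ∀ᶠ m in atTop, Real.log ((ϑ.pow m).toFun a).card ≤ c * (lam ^ m * L a + 1) := by
  have : Nonempty A := ⟨a⟩
  obtain ⟨U, hU, hcard⟩ := exists_card_le_coverMincard hprim hgeom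
  have hev := ExpGrowth.eventually_le_exp
    ((coverEntropyEntourage_le_topologicalEntropy ϑ hU).trans_lt hc)
  have ht : Tendsto (fun m => ⌈lam ^ m * L a⌉₊) atTop atTop :=
    tendsto_nat_ceil_atTop.comp
      ((tendsto_pow_atTop_atTop_of_one_lt hgeom.one_lt).atTop_mul_const (hgeom.pos a))
  have hmain : ∀ᶠ m in atTop, Real.log ((ϑ.pow m).toFun a).card ≤ c * ⌈lam ^ m * L a⌉₊ := by
    filter_upwards [ht.eventually hev] with m hm
    have h1 := hcard m a _ (Nat.le_ceil _)
    have h2 := (ENat.toENNReal_le.2 h1).trans hm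
    rw [EReal.exp_coe_mul_natCast, ENat.toENNReal_coe, ← ENNReal.ofReal_natCast,
      ENNReal.ofReal_le_ofReal_iff (Real.exp_pos _).le] at h2
    rwa [Real.log_le_iff_le_exp (by linarith [one_le_card_pow ϑ m a])]
  -- The sets of inflation words are non-empty, so their logarithmic counts are non-negative; this
  -- also excludes entropy `⊥` later.
  have hc0 : 0 ≤ c := by
    obtain ⟨m, hm⟩ := hmain.exists
    have h1 : (0 : ℝ) < ⌈lam ^ m * L a⌉₊ := by
      exact_mod_cast Nat.ceil_pos.2 (hgeom.pow_mul_pos m a)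
    exact nonneg_of_mul_nonneg_left
      ((Real.log_nonneg (one_le_card_pow ϑ m a)).trans hm) h1
  refine ⟨hc0, ?_⟩
  filter_upwards [hmain] with m hm
  refine hm.trans ?_
  gcongr
  exact (Nat.ceil_lt_add_one (hgeom.pow_mul_pos m a).le).le

/-- The topological entropy is bounded in terms of the level-`m` inflation words. -/
theorem topologicalEntropy_le [Nonempty A] {ϑ : RandomSubstitution A} (hprim : ϑ.IsPrimitive)
    {lam : ℝ} (hgeom : ϑ.IsGeomCompatible lam L) {l₀ H : ℝ} (hl₀ : 0 < l₀)
    (h₀ : ∀ a, l₀ ≤ L a) (m : ℕ) (hH : ∀ b, inflationRate ϑ lam L m b ≤ H) :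
    (ϑ.geometricHull L).topologicalEntropy ≤
      ((H + Real.log (Fintype.card A) / l₀ / lam ^ m : ℝ) : EReal) := by
  obtain ⟨-, l₁, -, -, h₁⟩ := exists_length_bounds hgeom.pos
  have hH0 : 0 ≤ H := (hgeom.inflationRate_nonneg m (Classical.arbitrary A)).trans (hH _)
  have hμ : 0 < lam ^ m := pow_pos (zero_lt_one.trans hgeom.one_lt) m
  refine iSup₂_le fun U hU => ?_
  obtain ⟨c, G, hc, hcover⟩ := exists_coverMincard_le ϑ hgeom.pos hU
  refine le_of_forall_gt_imp_ge_of_dense fun a' ha' => ?_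
  obtain ⟨a, ha, haa'⟩ := EReal.exists_between_coe_real ha'
  refine le_trans ?_ haa'.le
  rw [EReal.coe_lt_coe_iff] at ha
  set μ := lam ^ m
  set K := Real.log (Fintype.card A) / l₀ / μ with hK
  set B := Real.exp (Real.log (Fintype.card A) * ((c / μ + 2 * l₁) / l₀)) *
    Real.exp (H * (c + 2 * (μ * l₁)))
  -- All factors of the word count times `G` that are constant or polynomial in `n`; what remains is
  -- `exp ((H + K) * n)`, and any `a > H + K` absorbs `P`.
  let P : Polynomial ℝ := Polynomial.C (B * G) *
    (Polynomial.C (1 / μ / l₀) * Polynomial.X + Polynomial.C ((c / μ + 2 * l₁) / l₀ + 1)) *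
    (Polynomial.C (1 / l₀) * Polynomial.X + Polynomial.C ((c + 2 * (μ * l₁)) / l₀ + 1)) ^ 2
  have hev := Real.eventually_polynomial_mul_le_exp P (δ := a - (H + K)) (by linarith)
  refine Eventually.expGrowthSup_le ?_
  filter_upwards [hev] with n hn
  obtain ⟨W, hW, hcovW⟩ := hcover n
  refine (ENat.toENNReal_le.2 hcovW).trans ?_
  rw [EReal.exp_coe_mul_natCast, ENat.toENNReal_coe, ← ENNReal.ofReal_natCast]
  refine ENNReal.ofReal_le_ofReal ?_
  have hWcard := card_language_le hprim hgeom m hl₀ h₀ h₁ hH0 (fun b => by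
    rw [hgeom.log_card_eq]
    exact mul_le_mul_of_nonneg_right (hH b) (hgeom.pow_mul_pos m b).le)
    (show 0 ≤ n + c by positivity) hW
  push_cast
  calc (W.card : ℝ) * G ≤ _ * G := mul_le_mul_of_nonneg_right hWcard (Nat.cast_nonneg G)
    _ = P.eval (n : ℝ) * Real.exp ((H + K) * n) := by
      have e1 : Real.log (Fintype.card A) * (((n + c) / μ + 2 * l₁) / l₀) =
          Real.log (Fintype.card A) * ((c / μ + 2 * l₁) / l₀) + K * n := by
        rw [hK]; ring
      have e2 : H * (n + c + 2 * (μ * l₁)) = H * (c + 2 * (μ * l₁)) + H * n := by ring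
      have e3 : Real.exp ((H + K) * n) = Real.exp (H * n) * Real.exp (K * n) := by
        rw [← Real.exp_add]; ring_nf
      rw [e1, e2, e3, Real.exp_add, Real.exp_add]
      simp only [P, B, Polynomial.eval_mul, Polynomial.eval_add, Polynomial.eval_pow,
        Polynomial.eval_C, Polynomial.eval_X]
      ring
    _ ≤ Real.exp ((a - (H + K)) * n) * Real.exp ((H + K) * n) := by gcongr
    _ = Real.exp (a * n) := by rw [← Real.exp_add]; ring_nf

/-- Finiteness from above is the covering bound at level `0`. If the entropy were `⊥`, the
separation bound would apply with `c = -1` and force `0 ≤ -1`. -/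
theorem exists_topologicalEntropy_eq_coe [Nonempty A] {ϑ : RandomSubstitution A}
    (hprim : ϑ.IsPrimitive) {lam : ℝ} (hgeom : ϑ.IsGeomCompatible lam L) :
    ∃ h : ℝ, (ϑ.geometricHull L).topologicalEntropy = h := by
  obtain ⟨l₀, -, hl₀, h₀, -⟩ := exists_length_bounds hgeom.pos
  obtain ⟨b, hb⟩ := Finite.exists_max (inflationRate ϑ lam L 0)
  have htop := topologicalEntropy_le hprim hgeom hl₀ h₀ 0 hb
  refine ⟨_, (EReal.coe_toReal (ne_top_of_le_ne_top (EReal.coe_ne_top _) htop) ?_).symm⟩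
  intro hbot
  have := (eventually_log_card_le hprim hgeom (c := -1) (by rw [hbot]; exact EReal.bot_lt_coe _)
    (Classical.arbitrary A)).1
  linarith

/-- The inflation word entropies of all types agree with the topological entropy. -/
theorem tendsto_inflationRate {ϑ : RandomSubstitution A} (hprim : ϑ.IsPrimitive) {lam : ℝ}
    (hgeom : ϑ.IsGeomCompatible lam L) {h : ℝ}
    (hh : (ϑ.geometricHull L).topologicalEntropy = h) (a : A) :
    Tendsto (fun m => inflationRate ϑ lam L m a) atTop (𝓝 h) := by
  have : Nonempty A := ⟨a⟩
  obtain ⟨N, δ, hδ, hδ1, havg⟩ := exists_inflationRate_averaging hprim hgeom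
  refine tendsto_of_averaging hgeom.inflationRate_nonneg hδ hδ1 (fun c hc b => ?_)
    (fun c hc => ?_) havg a
  · obtain ⟨c', hc', hcc⟩ := exists_between hc
    have hev := (eventually_log_card_le hprim hgeom
      (by rw [hh]; exact EReal.coe_lt_coe_iff.2 hc') b).2
    have ht : Tendsto (fun m => lam ^ m * L b) atTop atTop :=
      (tendsto_pow_atTop_atTop_of_one_lt hgeom.one_lt).atTop_mul_const (hgeom.pos b)
    -- Past this threshold the additive `1` from rounding up the time is absorbed: `c' * (λᵐ L_b +
    -- 1) ≤ c * λᵐ L_b`.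
    filter_upwards [hev, ht.eventually_ge_atTop (c' / (c - c'))] with m hm hm'
    rw [inflationRate, div_le_iff₀ (hgeom.pow_mul_pos m b)]
    rw [div_le_iff₀ (by linarith)] at hm'
    linarith
  · obtain ⟨l₀, -, hl₀, h₀, -⟩ := exists_length_bounds hgeom.pos
    have ht : Tendsto (fun m => Real.log (Fintype.card A) / l₀ / lam ^ m) atTop (𝓝 0) :=
      (tendsto_pow_atTop_atTop_of_one_lt hgeom.one_lt).const_div_atTop _
    filter_upwards [ht.eventually (gt_mem_nhds (sub_pos.2 hc))] with m hm
    -- The letter of maximal rate may vary with `m`; the averaging argument allows this.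
    obtain ⟨b, hb⟩ := Finite.exists_max (inflationRate ϑ lam L m)
    have := topologicalEntropy_le hprim hgeom hl₀ h₀ m hb
    rw [hh, EReal.coe_le_coe_iff] at this
    exact ⟨b, by linarith⟩

end Entropy

end RandomSubstitution

theorem theoremA {A : Type*} [Fintype A] [DecidableEq A] [TopologicalSpace A]
    [DiscreteTopology A] (ϑ : RandomSubstitution A) (hprim : ϑ.IsPrimitive)
    (lam : ℝ) (L : A → ℝ) (hgeom : ϑ.IsGeomCompatible lam L) (a : A) :
    ∃ h : ℝ, ϑ.HasGeomInflationWordEntropy L a h ∧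
      (ϑ.geometricHull L).topologicalEntropy = (h : EReal) := by
  have : Nonempty A := ⟨a⟩
  obtain ⟨h, hh⟩ := RandomSubstitution.exists_topologicalEntropy_eq_coe hprim hgeom
  exact ⟨h, ⟨fun m => lam ^ m * L a, fun m => hgeom.inflates.pow m a,
    RandomSubstitution.tendsto_inflationRate hprim hgeom hh a⟩, hh⟩
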